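/- Let $\sigma\in\mathbb{R}$ (in particular $\sigma=\pm1$). Let $\phi_n(x)=(2^n n!\sqrt{\pi})^{-1/2}H_n(x)e^{-x^2/2}$, $n=0,1,2,\dots$, be the Hermite functions, where $H_n$ are the physicists' Hermite polynomials, and put $K_{n,n_1,n_2,n_3}=(\phi_n,\phi_{n_1}\phi_{n_2}\phi_{n_3})_{L^2(\mathbb{R})}$. For $s\in\mathbb{R}$ let $l^2_s(\mathbb{N})$ be the space of complex sequences $\mathbf{a}=(a_n)_{n\ge0}$ with $\|\mathbf{a}\|_{l^2_s}^2=\sum_{n\ge0}(1+n)^{2s}|a_n|^2<\infty$, and let $\mathcal{H}_1(\mathbb{R})=\{u\in H^1(\mathbb{R}) : xu\in L^2(\mathbb{R})\}$ with $\|u\|_{\mathcal{H}_1}^2=\int_{\mathbb{R}}\left(|u'|^2+(x^2+1)|u|^2\right)dx$ (complex-valued functions). (a) Every $u\in L^2(\mathbb{R})$ has the expansion $u=\sum_n a_n\phi_n$ in $L^2(\mathbb{R})$ with $a_n=(\phi_n,u)$, and $u\in\mathcal{H}_1(\mathbb{R})$ if and only if $\mathbf{a}\in l^2_{1/2}(\mathbb{N})$.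 Every $\mathbf{a}\in l^2_{1/2}(\mathbb{N})$ is the coefficient sequence of some $u\in\mathcal{H}_1(\mathbb{R})$, and $\|u\|_{\mathcal{H}_1}^2=2\|\mathbf{a}\|_{l^2_{1/2}}^2$. (b) The discrete dynamical system $$i\dot a_n=n a_n+\sigma\sum_{(n_1,n_2,n_3)}K_{n,n_1,n_2,n_3}\,a_{n_1}\bar a_{n_2}a_{n_3},\qquad n=0,1,2,\dots,$$ is globally well-posed in $l^2_{1/2}(\mathbb{N})$. That is, for every $\mathbf{a}_0\in l^2_{1/2}(\mathbb{N})$ there is a solution $\mathbf{a}\in C(\mathbb{R},l^2_{1/2}(\mathbb{N}))\cap C^1(\mathbb{R},l^2_{-1/2}(\mathbb{N}))$ with $\mathbf{a}(0)=\mathbf{a}_0$, for which the triple series converges unconditionally for every $n$ and every $t$. On every interval $I\ni 0$ it is the only solution that is continuous with values in $l^2_{1/2}(\mathbb{N})$ and equals $\mathbf{a}_0$ at $t=0$. The map $(t,\mathbf{a}_0)\mapsto\mathbf{a}(t)$ is continuous from $\mathbb{R}\times l^2_{1/2}(\mathbb{N})$ to $l^2_{1/2}(\mathbb{N})$. -/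

import Mathlib

open MeasureTheory Filter Topology Set
open scoped ContDiff

noncomputable section

/-! ### Hermite functions -/

/-- The (physicists') Hermite polynomials `H₀ = 1`, `H₁ = 2x`, `H₂ = 4x² - 2`, `H₃ = 8x³ - 12x`,
and so on, by the recursion `Hₙ₊₁ = 2x Hₙ - Hₙ'`. -/
def physHermite : ℕ → Polynomial ℝ
  | 0 => 1
  | n + 1 => 2 * Polynomial.X * physHermite n - Polynomial.derivative (physHermite n)

/-- The Hermite function `φₙ(x) = (2ⁿ n! √π)^(-1/2) Hₙ(x) exp(-x²/2)`. -/
def hermiteFun (n : ℕ) (x : ℝ) : ℝ :=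
  1 / √(2 ^ n * (n.factorial : ℝ) * √Real.pi) * (physHermite n).eval x * Real.exp (-x ^ 2 / 2)

/-- The Hermite coefficient `(φₙ, u)` of a function `u` (the `φₙ` are real-valued). -/
def hermiteCoeff (u : ℝ → ℂ) (n : ℕ) : ℂ := ∫ x, (hermiteFun n x : ℂ) * u x

/-- `u = ∑ aₙ φₙ`, with convergence in `L²(ℝ)`. -/
def IsHermiteExpansion (a : ℕ → ℂ) (u : ℝ → ℂ) : Prop :=
  Tendsto (fun N : ℕ =>
    eLpNorm (fun x => u x - ∑ n ∈ Finset.range N, a n * (hermiteFun n x : ℂ)) 2 volume)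
    atTop (𝓝 0)

/-- The coefficients `K_{n,n₁,n₂,n₃} = (φₙ, φₙ₁ φₙ₂ φₙ₃)`. -/
def hermiteK (n n₁ n₂ n₃ : ℕ) : ℝ :=
  ∫ x, hermiteFun n x * (hermiteFun n₁ x * hermiteFun n₂ x * hermiteFun n₃ x)

/-! ### The energy space -/

/-- `v` is the weak derivative of `u` on `ℝ`. -/
def IsWeakDeriv (u v : ℝ → ℂ) : Prop :=
  LocallyIntegrable u ∧ LocallyIntegrable v ∧
    ∀ ψ : ℝ → ℝ, ContDiff ℝ ∞ ψ → HasCompactSupport ψ →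
      ∫ x, u x * ((deriv ψ x : ℝ) : ℂ) = -∫ x, v x * (ψ x : ℂ)

/-- Membership in the energy space `{u ∈ H¹(ℝ) : x u ∈ L²(ℝ)}`. -/
def MemEnergySpace (u : ℝ → ℂ) : Prop :=
  MemLp u 2 ∧ (∃ v : ℝ → ℂ, MemLp v 2 ∧ IsWeakDeriv u v) ∧ MemLp (fun x : ℝ => (x : ℂ) * u x) 2

/-! ### The weighted sequence spaces -/

/-- Multiplication of a sequence by the weight `(1 + n)^s`. -/
def weightSeq (s : ℝ) : (ℕ → ℂ) →ₗ[ℂ] (ℕ → ℂ) where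
  toFun a n := (((1 + n : ℝ) ^ s : ℝ) : ℂ) * a n
  map_add' a b := by ext n; simp [mul_add]
  map_smul' c a := by ext n; simp [mul_left_comm]

/-- Membership in `l²_s(ℕ)`: the series `∑ (1 + n)^(2s) |aₙ|²` converges. -/
def MemWeightedL2 (s : ℝ) (a : ℕ → ℂ) : Prop :=
  Summable fun n : ℕ => (1 + n : ℝ) ^ (2 * s) * ‖a n‖ ^ 2

theorem norm_weightSeq_sq (s : ℝ) (a : ℕ → ℂ) (n : ℕ) :
    ‖weightSeq s a n‖ ^ 2 = (1 + n : ℝ) ^ (2 * s) * ‖a n‖ ^ 2 := by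
  have h : (0 : ℝ) ≤ 1 + n := by positivity
  have h2 : (1 + n : ℝ) ^ (2 * s) = ((1 + n : ℝ) ^ s) ^ 2 := by
    rw [mul_comm, Real.rpow_mul h]; norm_cast
  have h3 : ‖weightSeq s a n‖ = (1 + n : ℝ) ^ s * ‖a n‖ := by
    change ‖(((1 + n : ℝ) ^ s : ℝ) : ℂ) * a n‖ = _
    rw [norm_mul, Complex.norm_real, Real.norm_of_nonneg (Real.rpow_nonneg h s)]
  rw [h3, h2, mul_pow]

theorem memWeightedL2_iff (s : ℝ) (a : ℕ → ℂ) :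
    MemWeightedL2 s a ↔ Memℓp (weightSeq s a) 2 := by
  rw [memℓp_gen_iff (by norm_num), MemWeightedL2]
  simp [norm_weightSeq_sq]

/-- `l²_s(ℕ)` as a set of sequences. -/
def weightedL2Submodule (s : ℝ) : Submodule ℂ (ℕ → ℂ) where
  carrier := {a | MemWeightedL2 s a}
  add_mem' {a b} ha hb := by
    have h := ((memWeightedL2_iff s a).1 ha).add ((memWeightedL2_iff s b).1 hb)
    exact (memWeightedL2_iff s (a + b)).2 (by rwa [map_add])
  zero_mem' := by
    exact (memWeightedL2_iff s 0).2 (by rw [map_zero]; exact zero_memℓp)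
  smul_mem' c a ha := by
    have h := ((memWeightedL2_iff s a).1 ha).const_smul c
    exact (memWeightedL2_iff s (c • a)).2 (by rwa [map_smul])

/-- The space `l²_s(ℕ)`; its norm is introduced below. -/
def WeightedL2 (s : ℝ) : Type := weightedL2Submodule s

namespace WeightedL2

variable {s r : ℝ}

instance : AddCommGroup (WeightedL2 s) := inferInstanceAs (AddCommGroup (weightedL2Submodule s))

instance : Module ℂ (WeightedL2 s) := inferInstanceAs (Module ℂ (weightedL2Submodule s))

instance : CoeFun (WeightedL2 s) (fun _ => ℕ → ℂ) := ⟨fun a => a.1⟩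

/-- Multiplication by the weight, as a map into the unweighted `l²(ℕ)`. -/
def toLp (s : ℝ) : WeightedL2 s →ₗ[ℂ] lp (fun _ : ℕ => ℂ) 2 where
  toFun a := ⟨weightSeq s a.1, (memWeightedL2_iff s a.1).1 a.2⟩
  map_add' a b := Subtype.ext ((weightSeq s).map_add a.1 b.1)
  map_smul' c a := Subtype.ext ((weightSeq s).map_smul c a.1)

theorem toLp_injective (s : ℝ) : Function.Injective (toLp s) := by
  intro a b h
  refine Subtype.ext (funext fun n => ?_)
  have h1 : (((1 + n : ℝ) ^ s : ℝ) : ℂ) * a n = (((1 + n : ℝ) ^ s : ℝ) : ℂ) * b n :=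
    congrFun (congrArg Subtype.val h) n
  have h2 : (((1 + n : ℝ) ^ s : ℝ) : ℂ) ≠ 0 :=
    Complex.ofReal_ne_zero.2 (Real.rpow_pos_of_pos (by positivity) s).ne'
  exact mul_left_cancel₀ h2 h1

instance : NormedAddCommGroup (WeightedL2 s) :=
  NormedAddCommGroup.induced (WeightedL2 s) (lp (fun _ : ℕ => ℂ) 2) (toLp s) (toLp_injective s)

instance : NormedSpace ℂ (WeightedL2 s) :=
  NormedSpace.induced ℂ (WeightedL2 s) (lp (fun _ : ℕ => ℂ) 2) (toLp s)

/-- The norm of `l²_s(ℕ)` is given by `‖a‖² = ∑ (1 + n)^(2s) |aₙ|²`. -/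
theorem norm_sq_eq (a : WeightedL2 s) :
    ‖a‖ ^ 2 = ∑' n : ℕ, (1 + n : ℝ) ^ (2 * s) * ‖a n‖ ^ 2 := by
  have h := lp.norm_rpow_eq_tsum (p := 2) (by norm_num) (toLp s a)
  simp only [ENNReal.toReal_ofNat, Real.rpow_ofNat] at h
  exact h.trans (tsum_congr fun n => norm_weightSeq_sq s a.1 n)

/-- The inclusion `l²_s(ℕ) ⊆ l²_r(ℕ)` for `r ≤ s`. -/
def incl (h : r ≤ s) (a : WeightedL2 s) : WeightedL2 r :=
  ⟨a.1, Summable.of_nonneg_of_le (fun n => by positivity)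
    (fun n => mul_le_mul_of_nonneg_right
      (Real.rpow_le_rpow_of_exponent_le (by simp) (by linarith)) (by positivity)) a.2⟩

end WeightedL2

/-! ### The discrete system -/

/-- The curve `t ↦ a(t)`, `t ∈ I`, is continuous in `l²_{1/2}(ℕ)` and solves, for all `n`,
`i ȧₙ = n aₙ + σ ∑_{(n₁,n₂,n₃)} K_{n,n₁,n₂,n₃} aₙ₁ āₙ₂ aₙ₃`
at all times `t ∈ I`; the series has to converge (unconditionally), and the derivative is the
one-sided one at an end point that belongs to `I`. -/
def IsSolutionOn (σ : ℝ) (I : Set ℝ) (a : ℝ → WeightedL2 (1 / 2)) : Prop :=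
  ContinuousOn a I ∧ ∀ t ∈ I, ∀ n : ℕ, ∃ d S : ℂ,
    HasDerivWithinAt (fun τ => a τ n) d I t ∧
    HasSum (fun m : ℕ × ℕ × ℕ =>
      (hermiteK n m.1 m.2.1 m.2.2 : ℂ) * a t m.1 * star (a t m.2.1) * a t m.2.2) S ∧
    Complex.I * d = n * a t n + σ * S

/-- Global well-posedness of the discrete system in `l²_{1/2}(ℕ)`: there is a flow
`Φ t a₀`, `t ∈ ℝ`, jointly continuous in time and initial data, such that for every `a₀` the curve
`t ↦ Φ t a₀` is a solution on `ℝ` with value `a₀` at `t = 0`, is continuously differentiable with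
values in `l²_{-1/2}(ℕ)`, and is the only solution on each interval `I ∋ 0` with this
initial value. -/
def IsGloballyWellPosed (σ : ℝ) : Prop :=
  ∃ Φ : ℝ → WeightedL2 (1 / 2) → WeightedL2 (1 / 2),
    Continuous (fun p : ℝ × WeightedL2 (1 / 2) => Φ p.1 p.2) ∧
    ∀ a₀ : WeightedL2 (1 / 2),
      Φ 0 a₀ = a₀ ∧
      IsSolutionOn σ univ (fun t => Φ t a₀) ∧
      ContDiff ℝ 1 (fun t => WeightedL2.incl (r := -1 / 2) (by norm_num) (Φ t a₀)) ∧
      ∀ (I : Set ℝ) (b : ℝ → WeightedL2 (1 / 2)), I.OrdConnected → (0 : ℝ) ∈ I →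
        IsSolutionOn σ I b → b 0 = a₀ → ∀ t ∈ I, b t = Φ t a₀

end

/-!
The ladder operators `x ± d/dx` act on Hermite coefficients as weighted shifts. The parallelogram
law for `x u + u'` and `x u - u'` then gives the norm identity, and the duality of the two operators
against test functions shows that the decay of the coefficients characterises the energy space.
The Hermite functions are complete: if all coefficients of `u` vanish, then so do all moments of
`φ₀ u`, and as `φ₀ u` is integrable against every `e^{b|x|}`, its Fourier transform vanishes.

In one dimension `‖u‖_∞² ≤ 2 ‖u‖_{L²} ‖u'‖_{L²}`, so the energy space is an algebra, and the cubic
term is locally Lipschitz on `l²_{1/2}(ℕ)`. In the interaction picture `bₙ = e^{int} aₙ` the system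
becomes an ordinary differential equation with a locally Lipschitz right-hand side. Mass and energy
are conserved, and by the Gagliardo–Nirenberg inequality they control the norm for either sign of
`σ`. The global solution of the equation truncated outside a large ball therefore never leaves the
ball. Gronwall's inequality gives uniqueness and the continuity of the flow.
-/

noncomputable section

section Analysis

theorem tendsto_integral_mul_ofReal {α : Type*} [MeasurableSpace α] {μ : Measure α} {u : α → ℂ}
    {φ : ℕ → α → ℝ} {ψ bound : α → ℝ} (hu : AEStronglyMeasurable u μ)
    (hφ : ∀ k, AEStronglyMeasurable (φ k) μ) (hbound : Integrable bound μ)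
    (hle : ∀ k x, ‖u x * (φ k x : ℂ)‖ ≤ bound x)
    (hlim : ∀ x, Tendsto (fun k => φ k x) atTop (𝓝 (ψ x))) :
    Tendsto (fun k => ∫ x, u x * (φ k x : ℂ) ∂μ) atTop (𝓝 (∫ x, u x * (ψ x : ℂ) ∂μ)) :=
  tendsto_integral_of_dominated_convergence bound
    (fun k => hu.mul (Complex.continuous_ofReal.comp_aestronglyMeasurable (hφ k))) hbound
    (fun k => .of_forall (hle k))
    (.of_forall fun x => ((Complex.continuous_ofReal.tendsto _).comp (hlim x)).const_mul _)

theorem exists_cutoff : ∃ χ : ℕ → ℝ → ℝ, (∀ k, ContDiff ℝ ∞ (χ k)) ∧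
    (∀ k, HasCompactSupport (χ k)) ∧ (∀ k x, |χ k x| ≤ 1) ∧ (∃ M, ∀ k x, |deriv (χ k) x| ≤ M) ∧
    ∀ x, Tendsto (χ · x) atTop (𝓝 1) ∧ Tendsto (fun k => deriv (χ k) x) atTop (𝓝 0) := by
  let χ : ContDiffBump (0 : ℝ) := ⟨1, 2, one_pos, one_lt_two⟩
  obtain ⟨M, hM⟩ := (χ.contDiff.continuous_deriv (n := 1) le_rfl).bounded_above_of_compact_support
    χ.hasCompactSupport.deriv
  set r : ℕ → ℝ := fun k => 1 / ((k : ℝ) + 1) with hr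
  have hr_pos : ∀ k, 0 < r k := fun k => by positivity
  have hr_lim : Tendsto r atTop (𝓝 0) := tendsto_one_div_add_atTop_nhds_zero_nat
  have hderiv : ∀ k x, deriv (fun x => χ (r k * x)) x = r k * deriv χ (r k * x) := fun k x => by
    simpa using deriv_comp_mul_left (r k) χ x
  have hderiv_le : ∀ k x, |deriv (fun x => χ (r k * x)) x| ≤ r k * M := fun k x => by
    rw [hderiv, abs_mul, abs_of_pos (hr_pos k)]
    exact mul_le_mul_of_nonneg_left (hM _) (hr_pos k).le
  refine ⟨fun k x => χ (r k * x), fun k => χ.contDiff.comp (contDiff_const.mul contDiff_id),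
    fun k => χ.hasCompactSupport.comp_homeomorph (Homeomorph.mulLeft₀ (r k) (hr_pos k).ne'),
    fun k x => by simpa [abs_of_nonneg χ.nonneg] using χ.le_one, ⟨M, fun k x => ?_⟩,
    fun x => ⟨?_, ?_⟩⟩
  · have hr_le : r k ≤ 1 := by rw [hr, div_le_one (by positivity)]; simp
    exact (hderiv_le k x).trans (mul_le_of_le_one_left ((norm_nonneg _).trans (hM 0)) hr_le)
  · have h := (χ.continuous.tendsto 0).comp (by simpa using hr_lim.mul_const x :
      Tendsto (fun k => r k * x) atTop (𝓝 0))
    rwa [χ.one_of_mem_closedBall (Metric.mem_closedBall_self χ.rIn_pos.le)] at h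
  · exact squeeze_zero_norm (hderiv_le · x) (by simpa using hr_lim.mul_const M)

namespace IsWeakDeriv

variable {u v : ℝ → ℂ}

theorem of_hasDerivAt (h : ∀ x, HasDerivAt u (v x) x) (hv : LocallyIntegrable v) :
    IsWeakDeriv u v := by
  have hu : Continuous u := continuous_iff_continuousAt.2 fun x => (h x).continuousAt
  refine ⟨hu.locallyIntegrable, hv, fun ψ hψ hc => ?_⟩
  have hψ' : Continuous (deriv ψ) := hψ.continuous_deriv (by simp)
  have integrable_mul : ∀ {w : ℝ → ℂ} {φ : ℝ → ℝ}, LocallyIntegrable w → Continuous φ →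
      HasCompactSupport φ → Integrable fun x => w x * (φ x : ℂ) := fun hw hφ hcφ =>
    (hw.integrable_smul_right_of_hasCompactSupport (Complex.continuous_ofReal.comp hφ)
      (hcφ.comp_left rfl)).congr (Eventually.of_forall fun _ => rfl)
  exact integral_mul_deriv_eq_deriv_mul_of_integrable (fun x _ => h x)
    (fun x _ => ((hψ.differentiable (by simp) x).hasDerivAt).ofReal_comp)
    (integrable_mul hu.locallyIntegrable hψ' hc.deriv) (integrable_mul hv hψ.continuous hc)
    (integrable_mul hu.locallyIntegrable hψ.continuous hc)

theorem integral_mul_deriv (h : IsWeakDeriv u v) {ψ : ℝ → ℝ} (hψ : ContDiff ℝ ∞ ψ)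
    (huψ : Integrable fun x => u x * (ψ x : ℂ))
    (huψ' : Integrable fun x => u x * ((deriv ψ x : ℝ) : ℂ))
    (hvψ : Integrable fun x => v x * (ψ x : ℂ)) :
    ∫ x, u x * ((deriv ψ x : ℝ) : ℂ) = -∫ x, v x * (ψ x : ℂ) := by
  obtain ⟨χ, hχ, hχc, hχ_le, ⟨M, hM⟩, hχ_lim⟩ := exists_cutoff
  have hψ_diff : Differentiable ℝ ψ := hψ.differentiable (by simp)
  have hψ_cont := hψ.continuous
  have hψ'_cont : Continuous (deriv ψ) := hψ.continuous_deriv (by simp)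
  have hχ_cont : ∀ k, Continuous (χ k) := fun k => (hχ k).continuous
  have hχ'_cont : ∀ k, Continuous (deriv (χ k)) := fun k => (hχ k).continuous_deriv (by simp)
  have hcut : ∀ k, ∫ x, u x * ((deriv (χ k) x * ψ x + χ k x * deriv ψ x : ℝ) : ℂ) =
      -∫ x, v x * ((χ k x * ψ x : ℝ) : ℂ) := fun k => by
    have hderiv : ∀ x, deriv (fun x => χ k x * ψ x) x = deriv (χ k) x * ψ x + χ k x * deriv ψ x :=
      fun x => deriv_fun_mul ((hχ k).differentiable (by simp) x) (hψ_diff x)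
    simp_rw [← hderiv]
    exact h.2.2 (fun x => χ k x * ψ x) ((hχ k).mul hψ) (hχc k).mul_right
  have hlim_v : Tendsto (fun k => ∫ x, v x * ((χ k x * ψ x : ℝ) : ℂ)) atTop
      (𝓝 (∫ x, v x * (ψ x : ℂ))) := by
    refine tendsto_integral_mul_ofReal h.2.1.aestronglyMeasurable (fun k => by fun_prop) hvψ.norm
      (fun k x => ?_) fun x => ?_
    · simp only [norm_mul, Complex.norm_real, Real.norm_eq_abs, Complex.ofReal_mul]
      gcongr
      exact mul_le_of_le_one_left (abs_nonneg _) (hχ_le k x)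
    · simpa using (hχ_lim x).1.mul_const (ψ x)
  have hlim_u : Tendsto
      (fun k => ∫ x, u x * ((deriv (χ k) x * ψ x + χ k x * deriv ψ x : ℝ) : ℂ)) atTop
      (𝓝 (∫ x, u x * ((deriv ψ x : ℝ) : ℂ))) := by
    refine tendsto_integral_mul_ofReal h.1.aestronglyMeasurable (fun k => by fun_prop)
      ((huψ.norm.const_mul M).add huψ'.norm) (fun k x => ?_) fun x => ?_
    · simp only [Pi.add_apply, norm_mul, Complex.norm_real, Real.norm_eq_abs]
      calc ‖u x‖ * |deriv (χ k) x * ψ x + χ k x * deriv ψ x|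
          ≤ ‖u x‖ * (M * |ψ x| + 1 * |deriv ψ x|) := by
            grw [abs_add_le, abs_mul, abs_mul, hM k x, hχ_le k x]
        _ = M * (‖u x‖ * |ψ x|) + ‖u x‖ * |deriv ψ x| := by ring
    · simpa using ((hχ_lim x).2.mul_const (ψ x)).add ((hχ_lim x).1.mul_const (deriv ψ x))
  simp_rw [hcut] at hlim_u
  exact tendsto_nhds_unique hlim_u hlim_v.neg

theorem ae_eq {v' : ℝ → ℂ} (h : IsWeakDeriv u v) (h' : IsWeakDeriv u v') : v =ᵐ[volume] v' :=
  ae_eq_of_integral_contDiff_smul_eq h.2.1 h'.2.1 fun ψ hψ hc => by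
    simpa [mul_comm] using neg_injective ((h.2.2 ψ hψ hc).symm.trans (h'.2.2 ψ hψ hc))

end IsWeakDeriv

theorem integral_norm_mul_norm_le {α E F : Type*} [MeasurableSpace α] {μ : Measure α}
    [NormedAddCommGroup E] [NormedAddCommGroup F] {u : α → E} {v : α → F} (hu : MemLp u 2 μ)
    (hv : MemLp v 2 μ) :
    ∫ x, ‖u x‖ * ‖v x‖ ∂μ ≤ √(∫ x, ‖u x‖ ^ 2 ∂μ) * √(∫ x, ‖v x‖ ^ 2 ∂μ) := by
  have h := integral_mul_le_Lp_mul_Lq_of_nonneg (μ := μ) Real.HolderConjugate.two_two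
    (.of_forall fun x => norm_nonneg (u x)) (.of_forall fun x => norm_nonneg (v x))
    (by simpa using hu.norm) (by simpa using hv.norm)
  simpa [Real.sqrt_eq_rpow] using h

theorem norm_sq_le_of_hasDerivAt {F : Type*} [NormedAddCommGroup F] [InnerProductSpace ℝ F]
    {u v : ℝ → F} (h : ∀ x, HasDerivAt u (v x) x) (hu : MemLp u 2) (hv : MemLp v 2) (x : ℝ) :
    ‖u x‖ ^ 2 ≤ 2 * (√(∫ x, ‖u x‖ ^ 2) * √(∫ x, ‖v x‖ ^ 2)) := by
  have hderiv : ∀ x, HasDerivAt (fun x => ‖u x‖ ^ 2) (2 * inner ℝ (u x) (v x)) x :=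
    fun x => (h x).norm_sq
  have hle : ∀ x, ‖2 * inner ℝ (u x) (v x)‖ ≤ 2 * (‖u x‖ * ‖v x‖) := fun x => by
    grw [norm_mul, Real.norm_two, norm_inner_le_norm]
  have hprod : Integrable fun x => 2 * (‖u x‖ * ‖v x‖) :=
    (hu.norm.integrable_mul hv.norm).const_mul 2
  have hinner : Integrable fun x => 2 * inner ℝ (u x) (v x) :=
    hprod.mono' ((hu.1.inner hv.1).const_mul 2) (.of_forall hle)
  have hlim := tendsto_zero_of_hasDerivAt_of_integrableOn_Iic (a := x) (fun y _ => hderiv y)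
    hinner.integrableOn (hu.integrable_norm_pow two_ne_zero).integrableOn
  have hftc := integral_Iic_of_hasDerivAt_of_tendsto' (a := x) (fun y _ => hderiv y)
    hinner.integrableOn hlim
  calc ‖u x‖ ^ 2 = ∫ y in Iic x, 2 * inner ℝ (u y) (v y) := by rw [hftc, sub_zero]
    _ ≤ ∫ y in Iic x, 2 * (‖u y‖ * ‖v y‖) :=
        integral_mono hinner.integrableOn hprod.integrableOn
          fun y => (le_abs_self _).trans (hle y)
    _ ≤ ∫ y, 2 * (‖u y‖ * ‖v y‖) :=
        setIntegral_le_integral hprod (.of_forall fun y => by positivity)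
    _ = 2 * ∫ y, ‖u y‖ * ‖v y‖ := integral_const_mul _ _
    _ ≤ _ := by gcongr; exact integral_norm_mul_norm_le hu hv

open FourierTransform in
theorem ae_eq_zero_of_fourier_eq_zero {V E : Type*} [NormedAddCommGroup V]
    [InnerProductSpace ℝ V] [FiniteDimensional ℝ V] [MeasurableSpace V] [BorelSpace V]
    [NormedAddCommGroup E] [NormedSpace ℂ E] [CompleteSpace E] {g : V → E} (hg : Integrable g)
    (h : ∀ ξ, 𝓕 g ξ = 0) : ∀ᵐ x, g x = 0 := by
  refine ae_eq_zero_of_integral_contDiff_smul_eq_zero hg.locallyIntegrable fun ψ hψ hc => ?_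
  have hψ_comp : HasCompactSupport (Complex.ofRealCLM ∘ ψ) := hc.comp_left rfl
  set s := hψ_comp.toSchwartzMap (Complex.ofRealCLM.contDiff.comp hψ) with hs
  have hfourier_s : ∀ ξ, VectorFourier.fourierIntegral Real.fourierChar volume (innerₗ V)
      (𝓕⁻ s : SchwartzMap V ℂ) ξ = s ξ := fun ξ => by
    have hs_inv : 𝓕 (𝓕⁻ s : SchwartzMap V ℂ) = s := FourierTransform.fourier_fourierInv_eq s
    conv_rhs => rw [← hs_inv]
    rfl
  have hfourier_g : ∀ ξ,
      VectorFourier.fourierIntegral Real.fourierChar volume (innerₗ V).flip g ξ = 0 := fun ξ => by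
    rw [flip_innerₗ]
    exact h ξ
  have hflip := VectorFourier.integral_fourierIntegral_smul_eq_flip (L := innerₗ V)
    Real.continuous_fourierChar continuous_inner
    ((𝓕⁻ s : SchwartzMap V ℂ).integrable (μ := volume)) hg
  simp_rw [hfourier_s, hfourier_g] at hflip
  simpa [hs] using hflip

open FourierTransform in
theorem fourier_eq_zero_of_integral_pow_mul_eq_zero {g : ℝ → ℂ}
    (hg : ∀ b : ℝ, Integrable fun x => (Real.exp (b * |x|) : ℂ) * g x)
    (h : ∀ k : ℕ, ∫ x : ℝ, (x : ℂ) ^ k * g x = 0) (ξ : ℝ) : 𝓕 g ξ = 0 := by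
  rw [Real.fourier_real_eq_integral_exp_smul]
  have hg_meas : AEStronglyMeasurable g := by simpa using (hg 0).1
  set z : ℝ → ℂ := fun x => (↑(-2 * Real.pi * x * ξ) : ℂ) * Complex.I with hz
  have hz_norm : ∀ x, ‖z x‖ = (2 * Real.pi * |ξ|) * |x| := fun x => by
    simp only [hz, norm_mul, Complex.norm_I, mul_one, Complex.norm_real, Real.norm_eq_abs,
      abs_neg, abs_two, abs_of_pos Real.pi_pos]
    ring
  have hterm : ∀ k : ℕ, ∫ x, z x ^ k / (k.factorial : ℂ) * g x = 0 := fun k => by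
    have hfactor : ∀ x, z x ^ k / (k.factorial : ℂ) * g x =
        (-2 * Real.pi * ξ * Complex.I) ^ k / (k.factorial : ℂ) * ((x : ℂ) ^ k * g x) := fun x => by
      simp only [hz]; push_cast; ring
    simp_rw [hfactor, integral_const_mul, h, mul_zero]
  have hsum : HasSum (fun k : ℕ => ∫ x, z x ^ k / (k.factorial : ℂ) * g x)
      (∫ x, Complex.exp (z x) * g x) := by
    refine hasSum_integral_of_dominated_convergence
      (fun (k : ℕ) x => ‖z x‖ ^ k / k.factorial * ‖g x‖)
      (fun k => AEStronglyMeasurable.mul (by fun_prop) hg_meas)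
      (fun k => .of_forall fun x => by simp)
      (.of_forall fun x => (Real.summable_pow_div_factorial _).mul_right _) ?_
      (.of_forall fun x => ?_)
    · have hexp : ∀ x, ∑' k : ℕ, ‖z x‖ ^ k / k.factorial * ‖g x‖ =
          ‖(Real.exp ((2 * Real.pi * |ξ|) * |x|) : ℂ) * g x‖ := fun x => by
        rw [tsum_mul_right, ← hz_norm, norm_mul _ (g x), Complex.norm_real,
          Real.norm_eq_abs, Real.abs_exp, Real.exp_eq_exp_ℝ, NormedSpace.exp_eq_tsum_div]
      simp_rw [hexp]
      exact (hg _).norm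
    · rw [Complex.exp_eq_exp_ℂ]
      exact (NormedSpace.expSeries_div_hasSum_exp (z x)).mul_right _
  simp_rw [hterm] at hsum
  exact hsum.unique hasSum_zero

theorem ae_eq_zero_of_integral_pow_mul_eq_zero {g : ℝ → ℂ}
    (hg : ∀ b : ℝ, Integrable fun x => (Real.exp (b * |x|) : ℂ) * g x)
    (h : ∀ k : ℕ, ∫ x : ℝ, (x : ℂ) ^ k * g x = 0) : ∀ᵐ x, g x = 0 :=
  ae_eq_zero_of_fourier_eq_zero (by simpa using hg 0)
    (fourier_eq_zero_of_integral_pow_mul_eq_zero hg h)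

theorem integrable_eval_mul_exp_neg_mul_sq {b : ℝ} (hb : 0 < b) (p : Polynomial ℝ) :
    Integrable fun x => p.eval x * Real.exp (-b * x ^ 2) := by
  induction p using Polynomial.induction_on' with
  | add p q hp hq =>
    simp_rw [Polynomial.eval_add, add_mul]
    exact hp.add hq
  | monomial n a =>
    have h := integrable_rpow_mul_exp_neg_mul_sq hb (s := n) (by linarith [n.cast_nonneg (α := ℝ)])
    simp_rw [Real.rpow_natCast] at h
    simpa only [Polynomial.eval_monomial, mul_assoc] using h.const_mul a

end Analysis

section HermiteFunctions

/-- The constant `(2ⁿ n! √π)^(-1/2)` that normalises `φₙ` in `L²(ℝ)`. -/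
def hermiteNormConst (n : ℕ) : ℝ := 1 / √(2 ^ n * (n.factorial : ℝ) * √Real.pi)

theorem sqrt_mul_hermiteNormConst_succ (n : ℕ) :
    √(2 * (n + 1)) * hermiteNormConst (n + 1) = hermiteNormConst n := by
  have hfactorial : (2 : ℝ) ^ (n + 1) * ((n + 1).factorial : ℝ) * √Real.pi =
      2 * (n + 1) * (2 ^ n * (n.factorial : ℝ) * √Real.pi) := by
    rw [Nat.factorial_succ]; push_cast; ring
  rw [hermiteNormConst, hermiteNormConst, hfactorial,
    Real.sqrt_mul (by positivity : (0 : ℝ) ≤ 2 * (n + 1)), mul_one_div,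
    div_mul_cancel_left₀ (by positivity), one_div]

theorem hermiteNormConst_zero_sq : hermiteNormConst 0 ^ 2 = 1 / √Real.pi := by
  rw [hermiteNormConst, div_pow, Real.sq_sqrt (by positivity)]
  simp

theorem hermiteFun_eq_hermiteNormConst_mul (n : ℕ) (x : ℝ) :
    hermiteFun n x = hermiteNormConst n * (physHermite n).eval x * Real.exp (-x ^ 2 / 2) :=
  rfl

theorem derivative_physHermite_succ (n : ℕ) :
    Polynomial.derivative (physHermite (n + 1)) = 2 * ((n : Polynomial ℝ) + 1) * physHermite n := by
  induction n with
  | zero => simp [physHermite]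
  | succ n ih =>
    rw [physHermite, Polynomial.derivative_sub, Polynomial.derivative_mul, ih]
    conv_rhs => rw [physHermite]
    simp only [Polynomial.derivative_mul, Polynomial.derivative_X, Polynomial.derivative_add,
      Polynomial.derivative_one, Polynomial.derivative_natCast, Polynomial.derivative_ofNat]
    conv_lhs => rw [physHermite]
    push_cast
    ring

theorem contDiff_hermiteFun (n : ℕ) : ContDiff ℝ ∞ (hermiteFun n) := by
  have hp : ContDiff ℝ ∞ fun x => (physHermite n).eval x := by
    simpa using (physHermite n).contDiff_aeval (𝕜 := ℝ) ∞
  exact (contDiff_const.mul hp).mul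
    (Real.contDiff_exp.comp ((contDiff_id.pow 2).neg.div_const 2))

@[fun_prop]
theorem continuous_hermiteFun (n : ℕ) : Continuous (hermiteFun n) :=
  (contDiff_hermiteFun n).continuous

theorem hasDerivAt_hermiteFun (n : ℕ) (x : ℝ) :
    HasDerivAt (hermiteFun n) (deriv (hermiteFun n) x) x :=
  ((contDiff_hermiteFun n).differentiable (by simp) x).hasDerivAt

theorem mul_hermiteFun_sub_deriv (n : ℕ) (x : ℝ) :
    x * hermiteFun n x - deriv (hermiteFun n) x = √(2 * (n + 1)) * hermiteFun (n + 1) x := by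
  have hgauss : HasDerivAt (fun x : ℝ => Real.exp (-x ^ 2 / 2)) (Real.exp (-x ^ 2 / 2) * -x) x :=
    ((((hasDerivAt_pow 2 x).neg).div_const 2).congr_deriv (by push_cast; ring)).exp
  have hderiv : HasDerivAt (hermiteFun n) _ x :=
    (((physHermite n).hasDerivAt x).const_mul (hermiteNormConst n)).mul hgauss
  rw [hderiv.deriv, hermiteFun_eq_hermiteNormConst_mul, hermiteFun_eq_hermiteNormConst_mul,
    ← sqrt_mul_hermiteNormConst_succ n, physHermite]
  simp only [Polynomial.eval_sub, Polynomial.eval_mul, Polynomial.eval_ofNat, Polynomial.eval_X]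
  ring

/-- For `n = 0`, where `n - 1 = 0`, the right-hand side vanishes thanks to its coefficient. -/
theorem mul_hermiteFun_add_deriv (n : ℕ) (x : ℝ) :
    x * hermiteFun n x + deriv (hermiteFun n) x = √(2 * n) * hermiteFun (n - 1) x := by
  have hadd : x * hermiteFun n x + deriv (hermiteFun n) x =
      2 * x * hermiteFun n x - √(2 * (n + 1)) * hermiteFun (n + 1) x := by
    rw [← mul_hermiteFun_sub_deriv]; ring
  rw [hadd]
  cases n with
  | zero =>
    simp only [hermiteFun_eq_hermiteNormConst_mul, ← sqrt_mul_hermiteNormConst_succ 0, physHermite]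
    simp only [Polynomial.eval_sub, Polynomial.eval_mul, Polynomial.eval_ofNat, Polynomial.eval_X,
      Polynomial.derivative_one, Polynomial.eval_zero, Polynomial.eval_one]
    push_cast
    ring_nf
  | succ n =>
    have heval : (physHermite (n + 2)).eval x = 2 * x * (physHermite (n + 1)).eval x -
        2 * (n + 1) * (physHermite n).eval x := by
      rw [physHermite, derivative_physHermite_succ]; simp
    have hsq : √(2 * ((n : ℝ) + 1)) ^ 2 = 2 * (n + 1) := Real.sq_sqrt (by positivity)
    have hconst := sqrt_mul_hermiteNormConst_succ (n + 1)
    push_cast at hconst ⊢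
    simp only [hermiteFun_eq_hermiteNormConst_mul, heval,
      ← sqrt_mul_hermiteNormConst_succ n]
    linear_combination
      (-2 * x * (physHermite (n + 1)).eval x + 2 * (n + 1) * (physHermite n).eval x) *
        Real.exp (-x ^ 2 / 2) * hconst -
      hermiteNormConst (n + 1) * (physHermite n).eval x * Real.exp (-x ^ 2 / 2) * hsq

theorem two_mul_mul_hermiteFun (n : ℕ) (x : ℝ) : 2 * (x * hermiteFun n x) =
    √(2 * n) * hermiteFun (n - 1) x + √(2 * (n + 1)) * hermiteFun (n + 1) x := by
  rw [← mul_hermiteFun_sub_deriv, ← mul_hermiteFun_add_deriv]; ring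

theorem two_mul_deriv_hermiteFun (n : ℕ) (x : ℝ) : 2 * deriv (hermiteFun n) x =
    √(2 * n) * hermiteFun (n - 1) x - √(2 * (n + 1)) * hermiteFun (n + 1) x := by
  rw [← mul_hermiteFun_sub_deriv, ← mul_hermiteFun_add_deriv]; ring

theorem memLp_hermiteFun (n : ℕ) : MemLp (hermiteFun n) 2 := by
  refine (memLp_two_iff_integrable_sq (continuous_hermiteFun n).aestronglyMeasurable).2 ?_
  refine ((integrable_eval_mul_exp_neg_mul_sq one_pos (physHermite n ^ 2)).const_mul
    (hermiteNormConst n ^ 2)).congr (.of_forall fun x => ?_)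
  have hexp : Real.exp (-1 * x ^ 2) = Real.exp (-x ^ 2 / 2) ^ 2 := by
    rw [← Real.exp_nat_mul]; ring_nf
  simp only [Polynomial.eval_pow, hexp, hermiteFun, hermiteNormConst]
  ring

theorem memLp_mul_hermiteFun (n : ℕ) : MemLp (fun x => x * hermiteFun n x) 2 := by
  refine (((((memLp_hermiteFun (n - 1)).const_mul √(2 * n)).add
    ((memLp_hermiteFun (n + 1)).const_mul √(2 * (n + 1)))).const_mul (1 / 2))).ae_eq
    (.of_forall fun x => ?_)
  simp only [Pi.add_apply, ← two_mul_mul_hermiteFun]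
  ring

theorem memLp_deriv_hermiteFun (n : ℕ) : MemLp (deriv (hermiteFun n)) 2 := by
  refine (((((memLp_hermiteFun (n - 1)).const_mul √(2 * n)).sub
    ((memLp_hermiteFun (n + 1)).const_mul √(2 * (n + 1)))).const_mul (1 / 2))).ae_eq
    (.of_forall fun x => ?_)
  simp only [Pi.sub_apply, ← two_mul_deriv_hermiteFun]
  ring

end HermiteFunctions

section Coefficients

variable {u v : ℝ → ℂ}

theorem integrable_hermiteFun_mul (hu : MemLp u 2) (n : ℕ) :
    Integrable fun x => (hermiteFun n x : ℂ) * u x :=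
  (memLp_hermiteFun n).ofReal.integrable_mul hu

theorem integrable_mul_hermiteFun_mul (hu : MemLp u 2) (n : ℕ) :
    Integrable fun x => ((x * hermiteFun n x : ℝ) : ℂ) * u x :=
  (memLp_mul_hermiteFun n).ofReal.integrable_mul hu

theorem integrable_deriv_hermiteFun_mul (hu : MemLp u 2) (n : ℕ) :
    Integrable fun x => ((deriv (hermiteFun n) x : ℝ) : ℂ) * u x :=
  (memLp_deriv_hermiteFun n).ofReal.integrable_mul hu

theorem hermiteCoeff_congr_ae (h : u =ᵐ[volume] v) : hermiteCoeff u = hermiteCoeff v :=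
  funext fun _ => integral_congr_ae (h.mono fun x hx => by simp only [hx])

theorem hermiteCoeff_add (hu : MemLp u 2) (hv : MemLp v 2) (n : ℕ) :
    hermiteCoeff (fun x => u x + v x) n = hermiteCoeff u n + hermiteCoeff v n := by
  simp_rw [hermiteCoeff, mul_add]
  exact integral_add (integrable_hermiteFun_mul hu n) (integrable_hermiteFun_mul hv n)

theorem hermiteCoeff_const_mul (c : ℂ) (n : ℕ) :
    hermiteCoeff (fun x => c * u x) n = c * hermiteCoeff u n := by
  simp_rw [hermiteCoeff, mul_left_comm _ c]
  exact integral_const_mul c _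

theorem IsWeakDeriv.hermiteCoeff_eq (h : IsWeakDeriv u v) (hu : MemLp u 2) (hv : MemLp v 2)
    (n : ℕ) : hermiteCoeff v n = -∫ x, ((deriv (hermiteFun n) x : ℝ) : ℂ) * u x := by
  have hparts := h.integral_mul_deriv (contDiff_hermiteFun n)
    (by simpa only [mul_comm] using integrable_hermiteFun_mul hu n)
    (by simpa only [mul_comm] using integrable_deriv_hermiteFun_mul hu n)
    (by simpa only [mul_comm] using integrable_hermiteFun_mul hv n)
  simp_rw [hermiteCoeff, mul_comm _ (u _), hparts, neg_neg, mul_comm]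

theorem IsWeakDeriv.hermiteCoeff_mul_add (h : IsWeakDeriv u v) (hu : MemLp u 2) (hv : MemLp v 2)
    (n : ℕ) : hermiteCoeff (fun x => (x : ℂ) * u x + v x) n =
      (√(2 * (n + 1)) : ℂ) * hermiteCoeff u (n + 1) := by
  calc hermiteCoeff (fun x => (x : ℂ) * u x + v x) n
      = (∫ x, ((x * hermiteFun n x : ℝ) : ℂ) * u x) + hermiteCoeff v n := by
        rw [hermiteCoeff, hermiteCoeff, ← integral_add (integrable_mul_hermiteFun_mul hu n)
          (integrable_hermiteFun_mul hv n)]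
        congr! 2; push_cast; ring
    _ = ∫ x, ((x * hermiteFun n x - deriv (hermiteFun n) x : ℝ) : ℂ) * u x := by
        rw [h.hermiteCoeff_eq hu hv, ← sub_eq_add_neg, ← integral_sub
          (integrable_mul_hermiteFun_mul hu n) (integrable_deriv_hermiteFun_mul hu n)]
        push_cast
        simp_rw [sub_mul]
    _ = (√(2 * (n + 1)) : ℂ) * hermiteCoeff u (n + 1) := by
        simp_rw [mul_hermiteFun_sub_deriv, hermiteCoeff, Complex.ofReal_mul, mul_assoc]
        exact integral_const_mul _ _

theorem IsWeakDeriv.hermiteCoeff_mul_sub (h : IsWeakDeriv u v) (hu : MemLp u 2) (hv : MemLp v 2)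
    (n : ℕ) : hermiteCoeff (fun x => (x : ℂ) * u x - v x) n =
      (√(2 * n) : ℂ) * hermiteCoeff u (n - 1) := by
  calc hermiteCoeff (fun x => (x : ℂ) * u x - v x) n
      = (∫ x, ((x * hermiteFun n x : ℝ) : ℂ) * u x) - hermiteCoeff v n := by
        rw [hermiteCoeff, hermiteCoeff, ← integral_sub (integrable_mul_hermiteFun_mul hu n)
          (integrable_hermiteFun_mul hv n)]
        congr! 2; push_cast; ring
    _ = ∫ x, ((x * hermiteFun n x + deriv (hermiteFun n) x : ℝ) : ℂ) * u x := by
        rw [h.hermiteCoeff_eq hu hv, sub_neg_eq_add, ← integral_add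
          (integrable_mul_hermiteFun_mul hu n) (integrable_deriv_hermiteFun_mul hu n)]
        push_cast
        simp_rw [add_mul]
    _ = (√(2 * n) : ℂ) * hermiteCoeff u (n - 1) := by
        simp_rw [mul_hermiteFun_add_deriv, hermiteCoeff, Complex.ofReal_mul, mul_assoc]
        exact integral_const_mul _ _

theorem isWeakDeriv_hermiteFun (n : ℕ) :
    IsWeakDeriv (fun x => (hermiteFun n x : ℂ)) (fun x => ((deriv (hermiteFun n) x : ℝ) : ℂ)) :=
  .of_hasDerivAt (fun x => (hasDerivAt_hermiteFun n x).ofReal_comp)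
    ((memLp_deriv_hermiteFun n).ofReal.locallyIntegrable one_le_two)

theorem sqrt_mul_hermiteCoeff_hermiteFun_succ (n m : ℕ) :
    (√(2 * (n + 1)) : ℂ) * hermiteCoeff (fun x => (hermiteFun m x : ℂ)) (n + 1) =
      (√(2 * m) : ℂ) * hermiteCoeff (fun x => (hermiteFun (m - 1) x : ℂ)) n := by
  rw [← (isWeakDeriv_hermiteFun m).hermiteCoeff_mul_add (memLp_hermiteFun m).ofReal
    (memLp_deriv_hermiteFun m).ofReal, ← hermiteCoeff_const_mul]
  simp_rw [← Complex.ofReal_mul, ← Complex.ofReal_add, mul_hermiteFun_add_deriv]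

theorem sqrt_mul_hermiteCoeff_succ_hermiteFun (n m : ℕ) :
    (√(2 * (m + 1)) : ℂ) * hermiteCoeff (fun x => (hermiteFun (m + 1) x : ℂ)) n =
      (√(2 * n) : ℂ) * hermiteCoeff (fun x => (hermiteFun m x : ℂ)) (n - 1) := by
  rw [← (isWeakDeriv_hermiteFun m).hermiteCoeff_mul_sub (memLp_hermiteFun m).ofReal
    (memLp_deriv_hermiteFun m).ofReal, ← hermiteCoeff_const_mul]
  simp_rw [← Complex.ofReal_mul, ← Complex.ofReal_sub, mul_hermiteFun_sub_deriv]

theorem hermiteCoeff_hermiteFun_zero_zero :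
    hermiteCoeff (fun x => (hermiteFun 0 x : ℂ)) 0 = 1 := by
  have hgauss : ∀ x, hermiteFun 0 x * hermiteFun 0 x =
      hermiteNormConst 0 ^ 2 * Real.exp (-1 * x ^ 2) := fun x => by
    have hexp : Real.exp (-1 * x ^ 2) = Real.exp (-x ^ 2 / 2) * Real.exp (-x ^ 2 / 2) := by
      rw [← Real.exp_add]; ring_nf
    rw [hexp, hermiteFun_eq_hermiteNormConst_mul, physHermite, Polynomial.eval_one]
    ring
  have hint : ∫ x, hermiteFun 0 x * hermiteFun 0 x = 1 := by
    simp_rw [hgauss, integral_const_mul, integral_gaussian, hermiteNormConst_zero_sq, div_one]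
    exact one_div_mul_cancel (by positivity)
  rw [hermiteCoeff]
  exact_mod_cast congrArg ((↑) : ℝ → ℂ) hint

theorem hermiteCoeff_hermiteFun (n m : ℕ) :
    hermiteCoeff (fun x => (hermiteFun m x : ℂ)) n = if n = m then 1 else 0 := by
  have hsqrt : ∀ k : ℕ, (√(2 * (k + 1)) : ℂ) ≠ 0 := fun k =>
    Complex.ofReal_ne_zero.2 (by positivity)
  induction m generalizing n with
  | zero =>
    cases n with
    | zero => simpa using hermiteCoeff_hermiteFun_zero_zero
    | succ n =>
      have h := sqrt_mul_hermiteCoeff_hermiteFun_succ n 0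
      rw [Nat.cast_zero, mul_zero, Real.sqrt_zero, Complex.ofReal_zero, zero_mul] at h
      exact (mul_eq_zero.1 h).resolve_left (hsqrt n)
  | succ m ih =>
    refine mul_left_cancel₀ (hsqrt m) ((sqrt_mul_hermiteCoeff_succ_hermiteFun n m).trans ?_)
    cases n with
    | zero => simp
    | succ n => by_cases hnm : n = m <;> simp [ih, hnm]

end Coefficients

section Basis

variable {u v : ℝ → ℂ}

theorem hermiteFun_zero_pos (x : ℝ) : 0 < hermiteFun 0 x := by
  simp only [hermiteFun, physHermite, Polynomial.eval_one]
  positivity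

theorem memLp_exp_mul_hermiteFun_zero (b : ℝ) :
    MemLp (fun x => Real.exp (b * |x|) * hermiteFun 0 x) 2 := by
  have hcont : Continuous fun x => Real.exp (b * |x|) * hermiteFun 0 x := by fun_prop
  refine (memLp_two_iff_integrable_sq hcont.aestronglyMeasurable).2 ?_
  refine ((integrable_exp_neg_mul_sq (b := 1 / 2) (by norm_num)).const_mul
    (hermiteNormConst 0 ^ 2 * Real.exp (2 * b ^ 2))).mono' (hcont.pow 2).aestronglyMeasurable
    (.of_forall fun x => ?_)
  calc ‖(Real.exp (b * |x|) * hermiteFun 0 x) ^ 2‖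
      = hermiteNormConst 0 ^ 2 * Real.exp (2 * (b * |x| + -x ^ 2 / 2)) := by
        rw [Real.norm_of_nonneg (sq_nonneg _), hermiteFun_eq_hermiteNormConst_mul, physHermite,
          Polynomial.eval_one, two_mul, Real.exp_add, Real.exp_add]
        ring
    _ ≤ hermiteNormConst 0 ^ 2 * Real.exp (2 * b ^ 2 + -(1 / 2) * x ^ 2) := by
        gcongr
        nlinarith [sq_abs x, sq_nonneg (|x| - 2 * b)]
    _ = hermiteNormConst 0 ^ 2 * Real.exp (2 * b ^ 2) * Real.exp (-(1 / 2) * x ^ 2) := by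
        rw [Real.exp_add, mul_assoc]

theorem pow_succ_mul_hermiteFun_mul (k n : ℕ) (x : ℝ) (z : ℂ) :
    (x : ℂ) ^ (k + 1) * ((hermiteFun n x : ℂ) * z) =
      (√(2 * n) / 2 : ℂ) * ((x : ℂ) ^ k * ((hermiteFun (n - 1) x : ℂ) * z)) +
      (√(2 * (n + 1)) / 2 : ℂ) * ((x : ℂ) ^ k * ((hermiteFun (n + 1) x : ℂ) * z)) := by
  have h := congrArg ((↑) : ℝ → ℂ) (two_mul_mul_hermiteFun n x)
  simp only [Complex.ofReal_mul, Complex.ofReal_add, Complex.ofReal_ofNat] at h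
  linear_combination (x : ℂ) ^ k * z / 2 * h

theorem integrable_pow_mul_hermiteFun_mul (hu : MemLp u 2) (k n : ℕ) :
    Integrable fun x : ℝ => (x : ℂ) ^ k * ((hermiteFun n x : ℂ) * u x) := by
  induction k generalizing n with
  | zero => simpa using integrable_hermiteFun_mul hu n
  | succ k ih =>
    simp_rw [pow_succ_mul_hermiteFun_mul]
    exact ((ih _).const_mul _).add ((ih _).const_mul _)

theorem integral_pow_mul_hermiteFun_mul_eq_zero (hu : MemLp u 2) (h : ∀ n, hermiteCoeff u n = 0)
    (k n : ℕ) : ∫ x : ℝ, (x : ℂ) ^ k * ((hermiteFun n x : ℂ) * u x) = 0 := by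
  induction k generalizing n with
  | zero => simpa [hermiteCoeff] using h n
  | succ k ih =>
    have hint := integrable_pow_mul_hermiteFun_mul hu k
    simp_rw [pow_succ_mul_hermiteFun_mul]
    rw [integral_add ((hint _).const_mul _) ((hint _).const_mul _), integral_const_mul,
      integral_const_mul, ih, ih, mul_zero, mul_zero, add_zero]

theorem ae_eq_zero_of_hermiteCoeff_eq_zero (hu : MemLp u 2) (h : ∀ n, hermiteCoeff u n = 0) :
    u =ᵐ[volume] 0 := by
  have hzero : ∀ᵐ x, (hermiteFun 0 x : ℂ) * u x = 0 :=
    ae_eq_zero_of_integral_pow_mul_eq_zero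
      (fun b => by
        refine ((memLp_exp_mul_hermiteFun_zero b).ofReal.integrable_mul hu).congr
          (.of_forall fun x => ?_)
        simp [mul_assoc])
      (fun k => integral_pow_mul_hermiteFun_mul_eq_zero hu h k 0)
  filter_upwards [hzero] with x hx
  simpa [(hermiteFun_zero_pos x).ne'] using hx

theorem inner_toLp {α : Type*} [MeasurableSpace α] {μ : Measure α} {u v : α → ℂ}
    (hu : MemLp u 2 μ) (hv : MemLp v 2 μ) :
    inner ℂ (hu.toLp u) (hv.toLp v) = ∫ x, star (u x) * v x ∂μ := by
  rw [L2.inner_def]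
  refine integral_congr_ae ?_
  filter_upwards [hu.coeFn_toLp, hv.coeFn_toLp] with x hux hvx
  rw [hux, hvx, RCLike.inner_apply, mul_comm]
  rfl

theorem inner_hermiteFun_toLp (hu : MemLp u 2) (n : ℕ) :
    inner ℂ ((memLp_hermiteFun n).ofReal.toLp _) (hu.toLp u) = hermiteCoeff u n := by
  rw [inner_toLp, hermiteCoeff]
  simp

theorem orthonormal_hermiteFun : Orthonormal ℂ fun n =>
    ((memLp_hermiteFun n).ofReal.toLp _ : Lp ℂ 2 (volume : Measure ℝ)) := by
  rw [orthonormal_iff_ite]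
  intro n m
  rw [inner_hermiteFun_toLp]
  exact hermiteCoeff_hermiteFun n m

/-- The Hermite functions as a Hilbert basis of `L²(ℝ)`. -/
def hermiteBasis : HilbertBasis ℕ ℂ (Lp ℂ 2 (volume : Measure ℝ)) :=
  HilbertBasis.mkOfOrthogonalEqBot orthonormal_hermiteFun (by
    rw [Submodule.eq_bot_iff]
    intro f hf
    have hcoeff : ∀ n, hermiteCoeff f n = 0 := fun n => by
      rw [← inner_hermiteFun_toLp (Lp.memLp f), Lp.toLp_coeFn]
      exact (Submodule.mem_orthogonal _ f).1 hf _ (Submodule.subset_span ⟨n, rfl⟩)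
    rw [Lp.eq_zero_iff_ae_eq_zero]
    exact ae_eq_zero_of_hermiteCoeff_eq_zero (Lp.memLp f) hcoeff)

theorem hermiteBasis_apply (n : ℕ) :
    hermiteBasis n = (memLp_hermiteFun n).ofReal.toLp (fun x => (hermiteFun n x : ℂ)) := by
  rw [hermiteBasis, HilbertBasis.coe_mkOfOrthogonalEqBot]
  rfl

theorem hermiteBasis_repr_toLp (hu : MemLp u 2) (n : ℕ) :
    hermiteBasis.repr (hu.toLp u) n = hermiteCoeff u n := by
  rw [HilbertBasis.repr_apply_apply, hermiteBasis_apply]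
  exact inner_hermiteFun_toLp hu n

theorem exists_hermiteCoeff_eq {a : ℕ → ℂ} (ha : Summable fun n => ‖a n‖ ^ 2) :
    ∃ u : ℝ → ℂ, MemLp u 2 ∧ hermiteCoeff u = a := by
  have ha_mem : Memℓp a 2 := by
    rw [memℓp_gen_iff (by norm_num)]
    simpa using ha
  set f := hermiteBasis.repr.symm ⟨a, ha_mem⟩ with hf
  refine ⟨f, Lp.memLp f, funext fun n => ?_⟩
  rw [← hermiteBasis_repr_toLp (Lp.memLp f), Lp.toLp_coeFn, hf,
    LinearIsometryEquiv.apply_symm_apply]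

theorem hasSum_star_hermiteCoeff_mul (hu : MemLp u 2) (hv : MemLp v 2) :
    HasSum (fun n => star (hermiteCoeff u n) * hermiteCoeff v n) (∫ x, star (u x) * v x) := by
  have h := hermiteBasis.hasSum_inner_mul_inner (hu.toLp u) (hv.toLp v)
  rw [inner_toLp] at h
  refine h.congr_fun fun n => ?_
  rw [← inner_conj_symm (hu.toLp u), ← HilbertBasis.repr_apply_apply,
    ← HilbertBasis.repr_apply_apply, hermiteBasis_repr_toLp, hermiteBasis_repr_toLp]
  rfl

theorem hasSum_norm_hermiteCoeff_sq (hu : MemLp u 2) :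
    HasSum (fun n => ‖hermiteCoeff u n‖ ^ 2) (∫ x, ‖u x‖ ^ 2) := by
  have h := hasSum_star_hermiteCoeff_mul hu hu
  simp_rw [Complex.star_def, Complex.conj_mul', ← Complex.ofReal_pow] at h
  rw [integral_complex_ofReal] at h
  exact Complex.hasSum_ofReal.1 h

theorem isHermiteExpansion_hermiteCoeff (hu : MemLp u 2) :
    IsHermiteExpansion (hermiteCoeff u) u := by
  have hbasis : ∀ n, ⇑(hermiteBasis.repr (hu.toLp u) n • hermiteBasis n) =ᵐ[volume]
      fun x => hermiteCoeff u n * (hermiteFun n x : ℂ) := fun n => by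
    rw [hermiteBasis_repr_toLp, hermiteBasis_apply]
    have hφ : MemLp (fun x => (hermiteFun n x : ℂ)) 2 := (memLp_hermiteFun n).ofReal
    filter_upwards [Lp.coeFn_smul (hermiteCoeff u n) (hφ.toLp _), hφ.coeFn_toLp] with x hsmul htoLp
    rw [hsmul, Pi.smul_apply, htoLp, smul_eq_mul]
  have hlim := (Lp.tendsto_Lp_iff_tendsto_eLpNorm _ u hu).1
    (hermiteBasis.hasSum_repr (hu.toLp u)).tendsto_sum_nat
  refine hlim.congr fun N => ?_
  rw [eLpNorm_sub_comm]
  refine eLpNorm_congr_ae ?_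
  filter_upwards [Lp.coeFn_finsetSum (Finset.range N) fun n =>
    hermiteBasis.repr (hu.toLp u) n • hermiteBasis n, ae_all_iff.2 hbasis] with x hsum hx
  simp only [Pi.sub_apply, hsum, Finset.sum_apply, hx]

end Basis

section Energy

variable {u v : ℝ → ℂ}

theorem IsWeakDeriv.integral_star_mul_sub_mul {p q f : ℝ → ℂ} (h : IsWeakDeriv p q)
    (hp : MemLp p 2) (hq : MemLp q 2) (hxp : MemLp (fun x : ℝ => (x : ℂ) * p x) 2)
    (hu : MemLp u 2) (hf : MemLp f 2)
    (hfu : ∀ n, hermiteCoeff f n = (√(2 * (n + 1)) : ℂ) * hermiteCoeff u (n + 1)) :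
    ∫ x : ℝ, star ((x : ℂ) * p x - q x) * u x = ∫ x, star (p x) * f x := by
  have hleft := hasSum_star_hermiteCoeff_mul (u := fun x => (x : ℂ) * p x - q x) (hxp.sub hq) hu
  rw [← hasSum_nat_add_iff' 1] at hleft
  simp only [h.hermiteCoeff_mul_sub hp hq, Finset.range_one, Finset.sum_singleton,
    Nat.cast_zero, mul_zero, Real.sqrt_zero, Complex.ofReal_zero, zero_mul, star_zero, sub_zero,
    Nat.add_sub_cancel] at hleft
  refine hleft.unique ((hasSum_star_hermiteCoeff_mul hp hf).congr_fun fun n => ?_)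
  simp only [hfu, star_mul', Complex.star_def, Complex.conj_ofReal, Nat.cast_add, Nat.cast_one]
  ring

theorem IsWeakDeriv.integral_star_mul_add_mul {p q g : ℝ → ℂ} (h : IsWeakDeriv p q)
    (hp : MemLp p 2) (hq : MemLp q 2) (hxp : MemLp (fun x : ℝ => (x : ℂ) * p x) 2)
    (hu : MemLp u 2) (hg : MemLp g 2)
    (hgu : ∀ n, hermiteCoeff g n = (√(2 * n) : ℂ) * hermiteCoeff u (n - 1)) :
    ∫ x : ℝ, star ((x : ℂ) * p x + q x) * u x = ∫ x, star (p x) * g x := by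
  have hright := hasSum_star_hermiteCoeff_mul hp hg
  rw [← hasSum_nat_add_iff' 1] at hright
  simp only [hgu, Finset.range_one, Finset.sum_singleton, Nat.cast_zero, mul_zero, Real.sqrt_zero,
    Complex.ofReal_zero, zero_mul, sub_zero, Nat.add_sub_cancel] at hright
  refine (hasSum_star_hermiteCoeff_mul (u := fun x => (x : ℂ) * p x + q x)
    (hxp.add hq) hu).unique (hright.congr_fun fun n => ?_)
  simp only [h.hermiteCoeff_mul_add hp hq, star_mul', Complex.star_def, Complex.conj_ofReal,
    Nat.cast_add, Nat.cast_one]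
  ring

theorem norm_sqrt_mul_sq {r : ℝ} (hr : 0 ≤ r) (z : ℂ) : ‖(√r : ℂ) * z‖ ^ 2 = r * ‖z‖ ^ 2 := by
  rw [norm_mul, mul_pow, Complex.norm_real, Real.norm_eq_abs, sq_abs, Real.sq_sqrt hr]

theorem integral_norm_add_sq_add_norm_sub_sq {α : Type*} [MeasurableSpace α] {μ : Measure α}
    {f g : α → ℂ} (hf : MemLp f 2 μ) (hg : MemLp g 2 μ) :
    (∫ x, ‖f x + g x‖ ^ 2 ∂μ) + ∫ x, ‖f x - g x‖ ^ 2 ∂μ =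
      2 * ((∫ x, ‖f x‖ ^ 2 ∂μ) + ∫ x, ‖g x‖ ^ 2 ∂μ) := by
  have hint : ∀ {w : α → ℂ}, MemLp w 2 μ → Integrable (fun x => ‖w x‖ ^ 2) μ :=
    fun hw => hw.integrable_norm_pow two_ne_zero
  have hparallelogram : ∀ x, ‖f x + g x‖ ^ 2 + ‖f x - g x‖ ^ 2 =
      2 * (‖f x‖ ^ 2 + ‖g x‖ ^ 2) := fun x => by
    simpa only [← sq] using parallelogram_law_with_norm ℝ (f x) (g x)
  rw [← integral_add (hint hf) (hint hg), ← integral_const_mul, ← integral_congr_ae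
    (.of_forall hparallelogram)]
  exact (integral_add (hint (hf.add hg)) (hint (hf.sub hg))).symm

theorem IsWeakDeriv.hasSum_energy (h : IsWeakDeriv u v) (hu : MemLp u 2) (hv : MemLp v 2)
    (hxu : MemLp (fun x : ℝ => (x : ℂ) * u x) 2) :
    HasSum (fun n : ℕ => 2 * ((1 + n : ℝ) * ‖hermiteCoeff u n‖ ^ 2))
      ((∫ x : ℝ, ‖(x : ℂ) * u x‖ ^ 2) + (∫ x, ‖v x‖ ^ 2) + ∫ x, ‖u x‖ ^ 2) := by
  have hadd : HasSum (fun n : ℕ => 2 * (n : ℝ) * ‖hermiteCoeff u n‖ ^ 2)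
      (∫ x : ℝ, ‖(x : ℂ) * u x + v x‖ ^ 2) := by
    have hnonneg : ∀ n : ℕ, (0 : ℝ) ≤ 2 * (n + 1) := fun n => by positivity
    have hshift := hasSum_norm_hermiteCoeff_sq (u := fun x : ℝ => (x : ℂ) * u x + v x) (hxu.add hv)
    rw [← hasSum_nat_add_iff' 1]
    simp_rw [h.hermiteCoeff_mul_add hu hv, norm_sqrt_mul_sq (hnonneg _)] at hshift
    simpa using hshift
  have hsub : HasSum (fun n : ℕ => 2 * (n + 1 : ℝ) * ‖hermiteCoeff u n‖ ^ 2)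
      (∫ x : ℝ, ‖(x : ℂ) * u x - v x‖ ^ 2) := by
    have hnonneg : ∀ n : ℕ, (0 : ℝ) ≤ 2 * n := fun n => by positivity
    have hshift := hasSum_norm_hermiteCoeff_sq (u := fun x : ℝ => (x : ℂ) * u x - v x) (hxu.sub hv)
    rw [← hasSum_nat_add_iff' 1] at hshift
    simp_rw [h.hermiteCoeff_mul_sub hu hv, norm_sqrt_mul_sq (hnonneg _)] at hshift
    simpa using hshift
  have hsum := ((hadd.add hsub).mul_left (1 / 2)).add (hasSum_norm_hermiteCoeff_sq hu)
  rw [integral_norm_add_sq_add_norm_sub_sq hxu hv, ← mul_assoc, one_div_mul_cancel two_ne_zero,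
    one_mul] at hsum
  exact hsum.congr_fun fun n => by ring

theorem memLp_complex_ofReal_of_hasCompactSupport {ψ : ℝ → ℝ} (hψ : Continuous ψ)
    (hsupp : HasCompactSupport ψ) : MemLp (fun x => (ψ x : ℂ)) 2 :=
  (hψ.memLp_of_hasCompactSupport hsupp).ofReal

theorem exists_memLp_hermiteCoeff_ladder
    (hsum : Summable fun n : ℕ => (1 + n : ℝ) * ‖hermiteCoeff u n‖ ^ 2) :
    ∃ f g : ℝ → ℂ, MemLp f 2 ∧ MemLp g 2 ∧
      (∀ n, hermiteCoeff f n = (√(2 * (n + 1)) : ℂ) * hermiteCoeff u (n + 1)) ∧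
      ∀ n, hermiteCoeff g n = (√(2 * n) : ℂ) * hermiteCoeff u (n - 1) := by
  have hf : Summable fun n : ℕ => ‖(√(2 * (n + 1)) : ℂ) * hermiteCoeff u (n + 1)‖ ^ 2 := by
    refine (((summable_nat_add_iff 1).2 hsum).mul_left 2).of_nonneg_of_le
      (fun n => by positivity) fun n => ?_
    rw [norm_sqrt_mul_sq (by positivity), ← mul_assoc]
    gcongr ?_ * _
    push_cast
    linarith
  have hg : Summable fun n : ℕ => ‖(√(2 * n) : ℂ) * hermiteCoeff u (n - 1)‖ ^ 2 := by
    rw [← summable_nat_add_iff 1]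
    refine (hsum.mul_left 2).congr fun n => ?_
    rw [norm_sqrt_mul_sq (by positivity), Nat.add_sub_cancel]
    push_cast
    ring
  obtain ⟨f, hfLp, hfu⟩ := exists_hermiteCoeff_eq hf
  obtain ⟨g, hgLp, hgu⟩ := exists_hermiteCoeff_eq hg
  exact ⟨f, g, hfLp, hgLp, congrFun hfu, congrFun hgu⟩

theorem integral_mul_testFunction_of_hermiteCoeff_ladder {f g : ℝ → ℂ} (hu : MemLp u 2)
    (hf : MemLp f 2) (hg : MemLp g 2)
    (hfu : ∀ n, hermiteCoeff f n = (√(2 * (n + 1)) : ℂ) * hermiteCoeff u (n + 1))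
    (hgu : ∀ n, hermiteCoeff g n = (√(2 * n) : ℂ) * hermiteCoeff u (n - 1)) {ψ : ℝ → ℝ}
    (hψ : ContDiff ℝ ∞ ψ) (hsupp : HasCompactSupport ψ) :
    2 * ∫ x : ℝ, (ψ x : ℂ) * ((x : ℂ) * u x) = ∫ x, (ψ x : ℂ) * (f x + g x) ∧
      2 * ∫ x : ℝ, u x * ((deriv ψ x : ℝ) : ℂ) = -∫ x, (f x - g x) * (ψ x : ℂ) := by
  have hψ' : Continuous (deriv ψ) := hψ.continuous_deriv (by simp)
  have hp := memLp_complex_ofReal_of_hasCompactSupport hψ.continuous hsupp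
  have hq := memLp_complex_ofReal_of_hasCompactSupport hψ' hsupp.deriv
  have hxp : MemLp (fun x : ℝ => (x : ℂ) * (ψ x : ℂ)) 2 := by
    simpa using memLp_complex_ofReal_of_hasCompactSupport (continuous_id.mul hψ.continuous)
      hsupp.mul_left
  have hweak : IsWeakDeriv (fun x => (ψ x : ℂ)) (fun x => ((deriv ψ x : ℝ) : ℂ)) :=
    .of_hasDerivAt (fun x => (hψ.differentiable (by simp) x).hasDerivAt.ofReal_comp)
      (hq.locallyIntegrable one_le_two)
  have hxpu : Integrable fun x : ℝ => (x : ℂ) * (ψ x : ℂ) * u x := hxp.integrable_mul hu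
  have hqu : Integrable fun x => ((deriv ψ x : ℝ) : ℂ) * u x := hq.integrable_mul hu
  have hpf : Integrable fun x => (ψ x : ℂ) * f x := hp.integrable_mul hf
  have hpg : Integrable fun x => (ψ x : ℂ) * g x := hp.integrable_mul hg
  have hsub := hweak.integral_star_mul_sub_mul hp hq hxp hu hf hfu
  have hadd := hweak.integral_star_mul_add_mul hp hq hxp hu hg hgu
  simp only [star_sub, star_add, star_mul', Complex.star_def, Complex.conj_ofReal, sub_mul,
    add_mul, integral_sub hxpu hqu, integral_add hxpu hqu] at hsub hadd
  simp_rw [← mul_assoc, mul_comm _ (ψ _ : ℂ), mul_add, mul_sub, integral_add hpf hpg,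
    integral_sub hpf hpg, mul_comm (u _), ← hsub, ← hadd, mul_comm (ψ _ : ℂ)]
  exact ⟨by ring, by ring⟩

/- On the coefficient side `x u ± u'` are the ladder shifts `f` and `g`, so `x u` and `u'` have to
be `(f + g) / 2` and `(f - g) / 2`; both identities are checked against test functions. -/
theorem memEnergySpace_of_summable (hu : MemLp u 2)
    (hsum : Summable fun n : ℕ => (1 + n : ℝ) * ‖hermiteCoeff u n‖ ^ 2) : MemEnergySpace u := by
  obtain ⟨f, g, hf, hg, hfu, hgu⟩ := exists_memLp_hermiteCoeff_ladder hsum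
  have htest := fun ψ => integral_mul_testFunction_of_hermiteCoeff_ladder (ψ := ψ) hu hf hg hfu hgu
  have hadd : MemLp (fun x => 2⁻¹ * (f x + g x)) 2 := (hf.add hg).const_mul (2 : ℂ)⁻¹
  have hsub : MemLp (fun x => 2⁻¹ * (f x - g x)) 2 := (hf.sub hg).const_mul (2 : ℂ)⁻¹
  have huloc := hu.locallyIntegrable one_le_two
  refine ⟨hu, ⟨_, hsub, huloc, hsub.locallyIntegrable one_le_two, fun ψ hψ hsupp => ?_⟩,
    hadd.ae_eq (ae_eq_of_integral_contDiff_smul_eq (hadd.locallyIntegrable one_le_two)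
      (huloc.continuous_mul Complex.continuous_ofReal) fun ψ hψ hsupp => ?_)⟩
  · simp_rw [mul_assoc, integral_const_mul]
    linear_combination (htest ψ hψ hsupp).2 / 2
  · simp_rw [Complex.real_smul, mul_left_comm _ (2⁻¹ : ℂ), integral_const_mul]
    linear_combination -(htest ψ hψ hsupp).1 / 2

theorem one_add_rpow_two_mul_half (n : ℕ) : (1 + n : ℝ) ^ (2 * (1 / 2) : ℝ) = 1 + n := by
  norm_num

theorem memWeightedL2_half_iff {a : ℕ → ℂ} :
    MemWeightedL2 (1 / 2) a ↔ Summable fun n : ℕ => (1 + n : ℝ) * ‖a n‖ ^ 2 := by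
  simp_rw [MemWeightedL2, one_add_rpow_two_mul_half]

theorem WeightedL2.norm_half_sq (a : WeightedL2 (1 / 2)) :
    ‖a‖ ^ 2 = ∑' n : ℕ, (1 + n : ℝ) * ‖a n‖ ^ 2 := by
  simp_rw [WeightedL2.norm_sq_eq, one_add_rpow_two_mul_half]

theorem memEnergySpace_iff (hu : MemLp u 2) :
    MemEnergySpace u ↔ MemWeightedL2 (1 / 2) (hermiteCoeff u) := by
  rw [memWeightedL2_half_iff]
  refine ⟨fun ⟨_, ⟨v, hv, h⟩, hxu⟩ => ?_, memEnergySpace_of_summable hu⟩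
  exact (summable_mul_left_iff two_ne_zero).1 (h.hasSum_energy hu hv hxu).summable

theorem WeightedL2.summable_norm_sq (a : WeightedL2 (1 / 2)) : Summable fun n => ‖a n‖ ^ 2 :=
  (memWeightedL2_half_iff.1 a.2).of_nonneg_of_le (fun n => by positivity) fun n =>
    le_mul_of_one_le_left (by positivity) (by simp)

theorem exists_memEnergySpace (a : WeightedL2 (1 / 2)) :
    ∃ u : ℝ → ℂ, MemEnergySpace u ∧ hermiteCoeff u = a := by
  obtain ⟨u, hu, hua⟩ := exists_hermiteCoeff_eq a.summable_norm_sq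
  exact ⟨u, (memEnergySpace_iff hu).2 (hua ▸ a.2), hua⟩

theorem integral_energy_eq {a : WeightedL2 (1 / 2)} (hu : MemEnergySpace u)
    (h : IsWeakDeriv u v) (ha : hermiteCoeff u = a) :
    ∫ x, (‖v x‖ ^ 2 + (x ^ 2 + 1) * ‖u x‖ ^ 2) = 2 * ‖a‖ ^ 2 := by
  obtain ⟨hu2, ⟨w, hw, huw⟩, hxu⟩ := hu
  have hv : MemLp v 2 := hw.ae_eq (huw.ae_eq h)
  have hint : ∀ {w : ℝ → ℂ}, MemLp w 2 → Integrable fun x => ‖w x‖ ^ 2 :=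
    fun hw => hw.integrable_norm_pow two_ne_zero
  have hgrad : Integrable fun x : ℝ => ‖(x : ℂ) * u x‖ ^ 2 + ‖v x‖ ^ 2 := (hint hxu).add (hint hv)
  rw [WeightedL2.norm_half_sq, ← tsum_mul_left, ← ha, (h.hasSum_energy hu2 hv hxu).tsum_eq,
    ← integral_add (hint hxu) (hint hv), ← integral_add hgrad (hint hu2)]
  refine integral_congr_ae (.of_forall fun x => ?_)
  simp only [norm_mul, mul_pow, Complex.norm_real, Real.norm_eq_abs, sq_abs]
  ring

end Energy

section EnergyBound

variable {u w : ℝ → ℂ} {L M : ℝ}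

theorem integral_norm_mul_sq_le {α : Type*} [MeasurableSpace α] {μ : Measure α} {f g : α → ℂ}
    (hf : MemLp f 2 μ) {C : ℝ} (hg : ∀ x, ‖g x‖ ≤ C) :
    ∫ x, ‖f x * g x‖ ^ 2 ∂μ ≤ C ^ 2 * ∫ x, ‖f x‖ ^ 2 ∂μ := by
  rw [← integral_const_mul]
  refine integral_mono_of_nonneg (.of_forall fun x => by positivity)
    ((hf.integrable_norm_pow two_ne_zero).const_mul _) (.of_forall fun x => ?_)
  dsimp only
  grw [norm_mul, mul_pow, hg x, mul_comm]

theorem memLp_mul_of_norm_le {α : Type*} [MeasurableSpace α] {μ : Measure α} {p : ENNReal}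
    {f g : α → ℂ} (hf : MemLp f p μ) (hg : AEStronglyMeasurable g μ) {C : ℝ}
    (hC : ∀ x, ‖g x‖ ≤ C) : MemLp (fun x => f x * g x) p μ :=
  hf.of_le_mul (hf.1.mul hg) (.of_forall fun x => by grw [norm_mul, hC x, mul_comm])

theorem hasSum_energy_of_differentiable (hd : Differentiable ℝ u) (hu : MemLp u 2)
    (hxu : MemLp (fun x : ℝ => (x : ℂ) * u x) 2) (hu' : MemLp (deriv u) 2) :
    HasSum (fun n : ℕ => 2 * ((1 + n : ℝ) * ‖hermiteCoeff u n‖ ^ 2))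
      ((∫ x : ℝ, ‖(x : ℂ) * u x‖ ^ 2) + (∫ x, ‖deriv u x‖ ^ 2) + ∫ x, ‖u x‖ ^ 2) :=
  (IsWeakDeriv.of_hasDerivAt (fun x => (hd x).hasDerivAt)
    (hu'.locallyIntegrable one_le_two)).hasSum_energy hu hu' hxu

/-- `u` is a differentiable function in the energy space whose energy `∫ |x u|² + |u'|² + |u|²` is
at most `2 M²`, so that its Hermite coefficients have norm at most `M` in `l²_{1/2}(ℕ)`. -/
structure EnergyBound (u : ℝ → ℂ) (M : ℝ) : Prop where
  differentiable : Differentiable ℝ u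
  memLp : MemLp u 2
  memLp_mul_id : MemLp (fun x : ℝ => (x : ℂ) * u x) 2
  memLp_deriv : MemLp (deriv u) 2
  nonneg : 0 ≤ M
  energy_le : (∫ x : ℝ, ‖(x : ℂ) * u x‖ ^ 2) + (∫ x, ‖deriv u x‖ ^ 2) + ∫ x, ‖u x‖ ^ 2 ≤ 2 * M ^ 2

namespace EnergyBound

theorem sum_hermiteCoeff_le (h : EnergyBound u M) (s : Finset ℕ) :
    ∑ n ∈ s, (1 + n : ℝ) * ‖hermiteCoeff u n‖ ^ 2 ≤ M ^ 2 := by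
  have hsum := sum_le_hasSum s (fun n _ => by positivity)
    (hasSum_energy_of_differentiable h.differentiable h.memLp h.memLp_mul_id h.memLp_deriv)
  rw [← Finset.mul_sum] at hsum
  linarith [h.energy_le]

theorem integral_deriv_le (h : EnergyBound u M) : ∫ x, ‖deriv u x‖ ^ 2 ≤ 2 * M ^ 2 := by
  have hxu : 0 ≤ ∫ x : ℝ, ‖(x : ℂ) * u x‖ ^ 2 := integral_nonneg fun x => by positivity
  have hu : 0 ≤ ∫ x, ‖u x‖ ^ 2 := integral_nonneg fun x => by positivity
  linarith [h.energy_le]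

theorem norm_sq_le (h : EnergyBound u M) (x : ℝ) : ‖u x‖ ^ 2 ≤ 4 * (√(∫ x, ‖u x‖ ^ 2) * M) := by
  have hderiv : √(∫ x, ‖deriv u x‖ ^ 2) ≤ 2 * M :=
    Real.sqrt_le_iff.2 ⟨by linarith [h.nonneg], by nlinarith [h.integral_deriv_le]⟩
  calc ‖u x‖ ^ 2 ≤ 2 * (√(∫ x, ‖u x‖ ^ 2) * √(∫ x, ‖deriv u x‖ ^ 2)) :=
        norm_sq_le_of_hasDerivAt (fun x => (h.differentiable x).hasDerivAt) h.memLp h.memLp_deriv x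
    _ ≤ 2 * (√(∫ x, ‖u x‖ ^ 2) * (2 * M)) := by gcongr
    _ = 4 * (√(∫ x, ‖u x‖ ^ 2) * M) := by ring

theorem star (h : EnergyBound u M) : EnergyBound (fun x => star (u x)) M where
  differentiable := h.differentiable.star
  memLp := h.memLp.star
  memLp_mul_id := by
    simpa only [Pi.star_apply, star_mul', Complex.star_def, Complex.conj_ofReal, Pi.star_def]
      using h.memLp_mul_id.star
  memLp_deriv := by
    rw [deriv.star']
    exact h.memLp_deriv.star
  nonneg := h.nonneg
  energy_le := by simpa only [deriv.star, norm_mul, norm_star] using h.energy_le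

theorem integral_norm_sq_le (h : EnergyBound u M) : ∫ x, ‖u x‖ ^ 2 ≤ M ^ 2 := by
  have henergy := hasSum_energy_of_differentiable h.differentiable h.memLp h.memLp_mul_id
    h.memLp_deriv
  have hle : ∫ x, ‖u x‖ ^ 2 ≤ 2⁻¹ * _ :=
    hasSum_le (fun n => ?_) (hasSum_norm_hermiteCoeff_sq h.memLp) (henergy.mul_left 2⁻¹)
  · linarith [h.energy_le]
  · rw [inv_mul_cancel_left₀ two_ne_zero]
    exact le_mul_of_one_le_left (by positivity) (by simp)

theorem norm_le (h : EnergyBound u M) (x : ℝ) : ‖u x‖ ≤ 2 * M := by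
  have hnonneg := h.nonneg
  refine le_of_sq_le_sq ?_ (by positivity)
  grw [h.norm_sq_le x, h.integral_norm_sq_le, Real.sqrt_sq hnonneg]
  exact (by ring : 4 * (M * M) = (2 * M) ^ 2).le

theorem mul (hu : EnergyBound u L) (hw : EnergyBound w M) :
    EnergyBound (fun x => u x * w x) (4 * L * M) := by
  have hw' : MemLp (fun x => deriv u x * w x) 2 := memLp_mul_of_norm_le hu.memLp_deriv
    hw.memLp.1 hw.norm_le
  have hu' : MemLp (fun x => deriv w x * u x) 2 := memLp_mul_of_norm_le hw.memLp_deriv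
    hu.memLp.1 hu.norm_le
  have hxu : MemLp (fun x : ℝ => (x : ℂ) * u x * w x) 2 :=
    memLp_mul_of_norm_le hu.memLp_mul_id hw.memLp.1 hw.norm_le
  have hderiv : deriv (fun x => u x * w x) = fun x => deriv u x * w x + deriv w x * u x :=
    funext fun x => by
      rw [deriv_fun_mul (hu.differentiable x) (hw.differentiable x), mul_comm (u x)]
  refine ⟨hu.differentiable.mul hw.differentiable,
    memLp_mul_of_norm_le hu.memLp hw.memLp.1 hw.norm_le, by simpa only [mul_assoc] using hxu,
    hderiv ▸ hw'.add hu', by have := hu.nonneg; have := hw.nonneg; positivity, ?_⟩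
  have hxu_le := integral_norm_mul_sq_le hu.memLp_mul_id hw.norm_le
  have hu_le := integral_norm_mul_sq_le hu.memLp hw.norm_le
  have hderiv_le : ∫ x, ‖deriv u x * w x + deriv w x * u x‖ ^ 2 ≤
      2 * ((2 * M) ^ 2 * (∫ x, ‖deriv u x‖ ^ 2) + (2 * L) ^ 2 * ∫ x, ‖deriv w x‖ ^ 2) := by
    have hsub : 0 ≤ ∫ x, ‖deriv u x * w x - deriv w x * u x‖ ^ 2 :=
      integral_nonneg fun x => by positivity
    linarith [integral_norm_add_sq_add_norm_sub_sq hw' hu',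
      integral_norm_mul_sq_le hu.memLp_deriv hw.norm_le,
      integral_norm_mul_sq_le hw.memLp_deriv hu.norm_le]
  simp only [hderiv, ← mul_assoc]
  calc _ ≤ (2 * M) ^ 2 * ((∫ x : ℝ, ‖(x : ℂ) * u x‖ ^ 2) + (∫ x, ‖deriv u x‖ ^ 2) +
          ∫ x, ‖u x‖ ^ 2) + (2 * M) ^ 2 * (∫ x, ‖deriv u x‖ ^ 2) +
          2 * ((2 * L) ^ 2 * ∫ x, ‖deriv w x‖ ^ 2) := by linarith
    _ ≤ (2 * M) ^ 2 * (2 * L ^ 2) + (2 * M) ^ 2 * (2 * L ^ 2) +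
          2 * ((2 * L) ^ 2 * (2 * M ^ 2)) := by
        grw [hu.energy_le, hu.integral_deriv_le, hw.integral_deriv_le]
    _ = 2 * (4 * L * M) ^ 2 := by ring

end EnergyBound

end EnergyBound

section HermiteSum

variable {a : ℕ → ℂ}

/-- The finite Hermite series `∑_{n ∈ s} aₙ φₙ`. -/
def hermiteSum (s : Finset ℕ) (a : ℕ → ℂ) (x : ℝ) : ℂ := ∑ n ∈ s, a n * (hermiteFun n x : ℂ)

theorem hasDerivAt_hermiteSum (s : Finset ℕ) (a : ℕ → ℂ) (x : ℝ) :
    HasDerivAt (hermiteSum s a) (∑ n ∈ s, a n * ((deriv (hermiteFun n) x : ℝ) : ℂ)) x :=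
  HasDerivAt.fun_sum fun n _ => (hasDerivAt_hermiteFun n x).ofReal_comp.const_mul (a n)

theorem memLp_hermiteSum (s : Finset ℕ) (a : ℕ → ℂ) : MemLp (hermiteSum s a) 2 :=
  memLp_finsetSum _ fun n _ => (memLp_hermiteFun n).ofReal.const_mul _

theorem hermiteCoeff_hermiteSum (s : Finset ℕ) (a : ℕ → ℂ) (n : ℕ) :
    hermiteCoeff (hermiteSum s a) n = if n ∈ s then a n else 0 := by
  have hint : ∀ m ∈ s, Integrable fun x => (hermiteFun n x : ℂ) * (a m * (hermiteFun m x : ℂ)) :=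
    fun m _ => integrable_hermiteFun_mul ((memLp_hermiteFun m).ofReal.const_mul _) n
  have hcoeff : ∀ m, ∫ x, (hermiteFun n x : ℂ) * (a m * (hermiteFun m x : ℂ)) =
      if n = m then a m else 0 := fun m =>
    (hermiteCoeff_const_mul (a m) n).trans (by rw [hermiteCoeff_hermiteFun]; simp)
  simp_rw [hermiteCoeff, hermiteSum, Finset.mul_sum]
  simp [integral_finsetSum _ hint, hcoeff]

theorem integral_norm_hermiteSum_sq (s : Finset ℕ) (a : ℕ → ℂ) :
    ∫ x, ‖hermiteSum s a x‖ ^ 2 = ∑ n ∈ s, ‖a n‖ ^ 2 := by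
  rw [← (hasSum_norm_hermiteCoeff_sq (memLp_hermiteSum s a)).tsum_eq,
    tsum_eq_sum (s := s) fun n hn => by simp [hermiteCoeff_hermiteSum, hn]]
  exact Finset.sum_congr rfl fun n hn => by rw [hermiteCoeff_hermiteSum, if_pos hn]

theorem energyBound_hermiteSum {s : Finset ℕ} {M : ℝ} (hM : 0 ≤ M)
    (h : ∑ n ∈ s, (1 + n : ℝ) * ‖a n‖ ^ 2 ≤ M ^ 2) : EnergyBound (hermiteSum s a) M := by
  have hd : Differentiable ℝ (hermiteSum s a) :=
    fun x => (hasDerivAt_hermiteSum s a x).differentiableAt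
  have hxu : MemLp (fun x : ℝ => (x : ℂ) * hermiteSum s a x) 2 := by
    have hsum : MemLp (fun x : ℝ => ∑ n ∈ s, a n * ((x * hermiteFun n x : ℝ) : ℂ)) 2 :=
      memLp_finsetSum s fun n _ => (memLp_mul_hermiteFun n).ofReal.const_mul (a n)
    simpa only [hermiteSum, Finset.mul_sum, Complex.ofReal_mul, mul_left_comm] using hsum
  have hu' : MemLp (deriv (hermiteSum s a)) 2 := by
    rw [funext fun x => (hasDerivAt_hermiteSum s a x).deriv]
    exact memLp_finsetSum _ fun n _ => (memLp_deriv_hermiteFun n).ofReal.const_mul _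
  have henergy := hasSum_energy_of_differentiable hd (memLp_hermiteSum s a) hxu hu'
  refine ⟨hd, memLp_hermiteSum s a, hxu, hu', hM, ?_⟩
  rw [← henergy.tsum_eq, tsum_mul_left,
    tsum_eq_sum (s := s) fun n hn => by simp [hermiteCoeff_hermiteSum, hn]]
  gcongr
  exact (Finset.sum_congr rfl fun n hn => by rw [hermiteCoeff_hermiteSum, if_pos hn]).trans_le h

/- Choosing the phases of the coefficients so that all terms are nonnegative at the given `x`,
the pointwise bound for `∑ aₙ φₙ` becomes one for `∑ |aₙ φₙ|`. -/
theorem sq_sum_norm_mul_hermiteFun_le {s : Finset ℕ} {M : ℝ} (hM : 0 ≤ M)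
    (h : ∑ n ∈ s, (1 + n : ℝ) * ‖a n‖ ^ 2 ≤ M ^ 2) (x : ℝ) :
    (∑ n ∈ s, ‖a n * (hermiteFun n x : ℂ)‖) ^ 2 ≤ 4 * (√(∑ n ∈ s, ‖a n‖ ^ 2) * M) := by
  set b : ℕ → ℂ := fun n => ‖a n‖ * (SignType.sign (hermiteFun n x) : ℝ) with hb
  have hb_le : ∀ n, ‖b n‖ ≤ ‖a n‖ := fun n => by
    have hsign : |(SignType.sign (hermiteFun n x) : ℝ)| ≤ 1 := by
      rcases SignType.sign (hermiteFun n x) <;> simp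
    rw [hb, norm_mul, Complex.norm_real, Complex.norm_real, norm_norm, Real.norm_eq_abs]
    exact mul_le_of_le_one_right (norm_nonneg _) hsign
  have hb_mul : ∀ n, b n * (hermiteFun n x : ℂ) = (‖a n * (hermiteFun n x : ℂ)‖ : ℂ) := fun n => by
    rw [hb, mul_assoc, norm_mul, Complex.norm_real, Real.norm_eq_abs, ← sign_mul_self]
    push_cast
    rfl
  have hbM : ∑ n ∈ s, (1 + n : ℝ) * ‖b n‖ ^ 2 ≤ M ^ 2 := by
    refine h.trans' (Finset.sum_le_sum fun n _ => ?_)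
    gcongr
    exact hb_le n
  have hbound := (energyBound_hermiteSum hM hbM).norm_sq_le x
  rw [integral_norm_hermiteSum_sq, hermiteSum, Finset.sum_congr rfl fun n _ => hb_mul n,
    ← Complex.ofReal_sum, Complex.norm_real, Real.norm_eq_abs, sq_abs] at hbound
  grw [hbound]
  gcongr
  exact hb_le _

end HermiteSum

theorem hasSum_integral_of_sum_norm_le {α E ι : Type*} [MeasurableSpace α] {μ : Measure α}
    [NormedAddCommGroup E] [NormedSpace ℝ E] [Countable ι] {F : ι → α → E}
    {f : α → E} {g : α → ℝ} (hF : ∀ i, AEStronglyMeasurable (F i) μ) (hg : Integrable g μ)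
    (hle : ∀ (s : Finset ι) x, ∑ i ∈ s, ‖F i x‖ ≤ g x) (hf : ∀ x, HasSum (fun i => F i x) (f x)) :
    HasSum (fun i => ∫ x, F i x ∂μ) (∫ x, f x ∂μ) := by
  have hint : ∀ i, Integrable (F i) μ := fun i =>
    hg.mono' (hF i) (.of_forall fun x => by simpa using hle {i} x)
  have hsum : Summable fun i => ∫ x, ‖F i x‖ ∂μ := by
    refine summable_of_sum_le (c := ∫ x, g x ∂μ)
      (fun i => integral_nonneg fun x => norm_nonneg _) fun s => ?_
    rw [← integral_finsetSum s fun i _ => (hint i).norm]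
    exact integral_mono (integrable_finsetSum s fun i _ => (hint i).norm) hg (hle s)
  simpa only [fun x => (hf x).tsum_eq] using hasSum_integral_of_summable_integral_norm hint hsum

theorem integrable_hermiteFun (n : ℕ) : Integrable (hermiteFun n) := by
  refine ((integrable_eval_mul_exp_neg_mul_sq (b := 1 / 2) (by positivity)
    (physHermite n)).const_mul (hermiteNormConst n)).congr (.of_forall fun x => ?_)
  rw [hermiteFun_eq_hermiteNormConst_mul]
  ring_nf

namespace WeightedL2

section

variable {s : ℝ}

theorem add_apply (a b : WeightedL2 s) (n : ℕ) : (a + b) n = a n + b n := rfl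

theorem sub_apply (a b : WeightedL2 s) (n : ℕ) : (a - b) n = a n - b n := rfl

theorem smul_apply (c : ℂ) (a : WeightedL2 s) (n : ℕ) : (c • a) n = c * a n := rfl

@[ext] theorem ext {a b : WeightedL2 s} (h : ∀ n, a n = b n) : a = b := Subtype.ext (funext h)

end

/-- The square of the norm of the sequence in the unweighted space `l²(ℕ)`. -/
def mass (a : WeightedL2 (1 / 2)) : ℝ := ∑' n : ℕ, ‖a n‖ ^ 2

variable (a b : WeightedL2 (1 / 2))

theorem summable_half : Summable fun n : ℕ => (1 + n : ℝ) * ‖a n‖ ^ 2 :=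
  memWeightedL2_half_iff.1 a.2

theorem mass_nonneg : 0 ≤ a.mass := tsum_nonneg fun _ => by positivity

theorem mass_le : a.mass ≤ ‖a‖ ^ 2 := by
  rw [norm_half_sq]
  exact a.summable_norm_sq.tsum_le_tsum
    (fun n => le_mul_of_one_le_left (by positivity) (by simp)) a.summable_half

theorem sum_one_add_mul_norm_sq_le (s : Finset ℕ) :
    ∑ n ∈ s, (1 + n : ℝ) * ‖a n‖ ^ 2 ≤ ‖a‖ ^ 2 := by
  rw [norm_half_sq]
  exact a.summable_half.sum_le_tsum s fun n _ => by positivity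

theorem energyBound_hermiteSum (s : Finset ℕ) : EnergyBound (hermiteSum s a) ‖a‖ :=
  _root_.energyBound_hermiteSum (norm_nonneg a) (a.sum_one_add_mul_norm_sq_le s)

theorem sum_norm_mul_hermiteFun_le (s : Finset ℕ) (x : ℝ) :
    ∑ n ∈ s, ‖a n * (hermiteFun n x : ℂ)‖ ≤ √(4 * (√a.mass * ‖a‖)) := by
  refine Real.le_sqrt_of_sq_le ?_
  grw [sq_sum_norm_mul_hermiteFun_le (norm_nonneg a) (a.sum_one_add_mul_norm_sq_le s) x]
  gcongr
  exact a.summable_norm_sq.sum_le_tsum s fun n _ => by positivity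

theorem sqrt_four_mul_sqrt_mass_mul_norm_le : √(4 * (√a.mass * ‖a‖)) ≤ 2 * ‖a‖ := by
  refine Real.sqrt_le_iff.2 ⟨by positivity, ?_⟩
  grw [a.mass_le, Real.sqrt_sq (norm_nonneg a)]
  exact (by ring : 4 * (‖a‖ * ‖a‖) = (2 * ‖a‖) ^ 2).le

theorem summable_norm_mul_hermiteFun (x : ℝ) : Summable fun n => ‖a n * (hermiteFun n x : ℂ)‖ :=
  summable_of_sum_le (fun _ => norm_nonneg _) fun s => a.sum_norm_mul_hermiteFun_le s x

/-- The function `∑ aₙ φₙ` with Hermite coefficients `a`, as a pointwise absolutely convergent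
series. -/
def eval (x : ℝ) : ℂ := ∑' n, a n * (hermiteFun n x : ℂ)

theorem hasSum_eval (x : ℝ) : HasSum (fun n => a n * (hermiteFun n x : ℂ)) (a.eval x) :=
  (a.summable_norm_mul_hermiteFun x).of_norm.hasSum

theorem eval_add (x : ℝ) : (a + b).eval x = a.eval x + b.eval x := by
  refine (hasSum_eval (a + b) x).unique ?_
  simp_rw [add_apply, add_mul]
  exact (hasSum_eval a x).add (hasSum_eval b x)

theorem tsum_norm_mul_hermiteFun_le (x : ℝ) :
    ∑' n, ‖a n * (hermiteFun n x : ℂ)‖ ≤ √(4 * (√a.mass * ‖a‖)) :=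
  Real.tsum_le_of_sum_le (fun _ => norm_nonneg _) fun s => a.sum_norm_mul_hermiteFun_le s x

theorem norm_eval_sq_le (x : ℝ) : ‖a.eval x‖ ^ 2 ≤ 4 * (√a.mass * ‖a‖) := by
  have hle : ‖a.eval x‖ ≤ √(4 * (√a.mass * ‖a‖)) :=
    (norm_tsum_le_tsum_norm (a.summable_norm_mul_hermiteFun x)).trans
      (a.tsum_norm_mul_hermiteFun_le x)
  grw [hle, Real.sq_sqrt (by positivity)]

theorem norm_eval_le (x : ℝ) : ‖a.eval x‖ ≤ 2 * ‖a‖ := by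
  grw [← a.sqrt_four_mul_sqrt_mass_mul_norm_le]
  exact Real.le_sqrt_of_sq_le (a.norm_eval_sq_le x)

theorem tendsto_hermiteSum (x : ℝ) :
    Tendsto (fun N => hermiteSum (Finset.range N) a x) atTop (𝓝 (a.eval x)) :=
  (a.hasSum_eval x).tendsto_sum_nat

theorem measurable_eval : Measurable a.eval :=
  measurable_of_tendsto_metrizable
    (fun N => (a.energyBound_hermiteSum (Finset.range N)).differentiable.continuous.measurable)
    (tendsto_pi_nhds.2 a.tendsto_hermiteSum)

theorem exists_memLp_ae_eq_eval :
    ∃ u : ℝ → ℂ, MemLp u 2 ∧ hermiteCoeff u = a ∧ u =ᵐ[volume] a.eval := by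
  obtain ⟨u, hu, hua⟩ := exists_hermiteCoeff_eq a.summable_norm_sq
  have hmeas (N : ℕ) : AEStronglyMeasurable (fun x => u x - hermiteSum (Finset.range N) a x) :=
    hu.1.sub (memLp_hermiteSum _ _).1
  have hlim : Tendsto (fun N => eLpNorm (fun x => u x - hermiteSum (Finset.range N) a x) 2 volume)
      atTop (𝓝 0) := hua ▸ isHermiteExpansion_hermiteCoeff hu
  have hle : eLpNorm (fun x => u x - a.eval x) 2 volume ≤ 0 :=
    (Lp.eLpNorm_lim_le_liminf_eLpNorm hmeas _
      (.of_forall fun x => (a.tendsto_hermiteSum x).const_sub (u x))).trans_eq hlim.liminf_eq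
  have hzero := (eLpNorm_eq_zero_iff (hu.1.sub a.measurable_eval.aestronglyMeasurable)
    two_ne_zero).1 (nonpos_iff_eq_zero.1 hle)
  exact ⟨u, hu, hua, hzero.mono fun x => sub_eq_zero.1⟩

theorem memLp_eval : MemLp a.eval 2 := by
  obtain ⟨u, hu, -, h⟩ := a.exists_memLp_ae_eq_eval
  exact hu.ae_eq h

theorem hermiteCoeff_eval : hermiteCoeff a.eval = a := by
  obtain ⟨u, -, hua, h⟩ := a.exists_memLp_ae_eq_eval
  rw [← hermiteCoeff_congr_ae h, hua]

theorem integral_norm_eval_sq : ∫ x, ‖a.eval x‖ ^ 2 = a.mass := by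
  rw [← (hasSum_norm_hermiteCoeff_sq a.memLp_eval).tsum_eq, hermiteCoeff_eval, mass]

end WeightedL2

theorem hasSum_mul_mul_of_summable_norm {ι κ τ R : Type*} [NormedRing R] [CompleteSpace R]
    {f : ι → R} {g : κ → R} {h : τ → R} (hf : Summable fun i => ‖f i‖)
    (hg : Summable fun k => ‖g k‖) (hh : Summable fun j => ‖h j‖) :
    HasSum (fun m : ι × κ × τ => f m.1 * (g m.2.1 * h m.2.2))
      ((∑' i, f i) * ((∑' k, g k) * ∑' j, h j)) := by
  have hgh : HasSum (fun m : κ × τ => g m.1 * h m.2) ((∑' k, g k) * ∑' j, h j) :=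
    hg.of_norm.hasSum.mul hh.of_norm.hasSum (summable_mul_of_summable_norm hg hh)
  have hgh_norm : Summable fun m : κ × τ => ‖g m.1 * h m.2‖ := hg.mul_norm hh
  have hsum := hf.of_norm.hasSum.mul hgh
    (summable_mul_of_summable_norm (g := fun m : κ × τ => g m.1 * h m.2) hf hgh_norm)
  exact hsum

namespace WeightedL2

variable (a b c : WeightedL2 (1 / 2))

/-- The cubic expression `u ū' u''` in the functions `u`, `u'`, `u''` with coefficients `a`, `b`,
`c`. -/
def evalMul (x : ℝ) : ℂ := a.eval x * star (b.eval x) * c.eval x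

theorem memLp_evalMul : MemLp (evalMul a b c) 2 :=
  memLp_mul_of_norm_le
    (memLp_mul_of_norm_le a.memLp_eval b.measurable_eval.aestronglyMeasurable.star
      fun x => (norm_star _).trans_le (b.norm_eval_le x))
    c.measurable_eval.aestronglyMeasurable c.norm_eval_le

theorem tendsto_hermiteCoeff_hermiteSum_mul (n : ℕ) :
    Tendsto (fun N => hermiteCoeff (fun x => hermiteSum (Finset.range N) a x *
      star (hermiteSum (Finset.range N) b x) * hermiteSum (Finset.range N) c x) n) atTop
      (𝓝 (hermiteCoeff (evalMul a b c) n)) := by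
  have hcont (a : WeightedL2 (1 / 2)) (N : ℕ) : Continuous (hermiteSum (Finset.range N) a) :=
    (a.energyBound_hermiteSum (Finset.range N)).differentiable.continuous
  have hle (a : WeightedL2 (1 / 2)) (N : ℕ) := (a.energyBound_hermiteSum (Finset.range N)).norm_le
  refine tendsto_integral_of_dominated_convergence
    (fun x => ‖hermiteFun n x‖ * ((2 * ‖a‖) * (2 * ‖b‖) * (2 * ‖c‖))) (fun N => ?_)
    ((integrable_hermiteFun n).norm.mul_const _) (fun N => .of_forall fun x => ?_)
    (.of_forall fun x => ?_)
  · have := hcont a N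
    have := hcont b N
    have := hcont c N
    fun_prop
  · rw [norm_mul, Complex.norm_real, norm_mul, norm_mul, norm_star]
    grw [hle a N x, hle b N x, hle c N x]
  · exact (((a.tendsto_hermiteSum x).mul (b.tendsto_hermiteSum x).star).mul
      (c.tendsto_hermiteSum x)).const_mul _

theorem sum_hermiteCoeff_evalMul_le (s : Finset ℕ) :
    ∑ n ∈ s, (1 + n : ℝ) * ‖hermiteCoeff (evalMul a b c) n‖ ^ 2 ≤
      (16 * ‖a‖ * ‖b‖ * ‖c‖) ^ 2 := by
  refine le_of_tendsto' (tendsto_finsetSum _ fun n _ =>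
    ((tendsto_hermiteCoeff_hermiteSum_mul a b c n).norm.pow 2).const_mul _) fun N => ?_
  refine ((((a.energyBound_hermiteSum (Finset.range N)).mul
    (b.energyBound_hermiteSum (Finset.range N)).star).mul
    (c.energyBound_hermiteSum (Finset.range N))).sum_hermiteCoeff_le s).trans_eq ?_
  ring

/-- The coefficients of `u ū' u''` as a function of those of `u`, `u'`, `u''`. -/
def trilinear : WeightedL2 (1 / 2) :=
  ⟨hermiteCoeff (evalMul a b c), memWeightedL2_half_iff.2
    (summable_of_sum_le (fun n => by positivity) (sum_hermiteCoeff_evalMul_le a b c))⟩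

theorem trilinear_apply (n : ℕ) : trilinear a b c n = hermiteCoeff (evalMul a b c) n := rfl

theorem norm_trilinear_le : ‖trilinear a b c‖ ≤ 16 * ‖a‖ * ‖b‖ * ‖c‖ := by
  refine le_of_sq_le_sq ?_ (by positivity)
  rw [norm_half_sq]
  exact Real.tsum_le_of_sum_le (fun n => by positivity) (sum_hermiteCoeff_evalMul_le a b c)

theorem trilinear_add_left (a' : WeightedL2 (1 / 2)) :
    trilinear (a + a') b c = trilinear a b c + trilinear a' b c := by
  ext n
  rw [add_apply, trilinear_apply, trilinear_apply, trilinear_apply,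
    ← hermiteCoeff_add (memLp_evalMul _ _ _) (memLp_evalMul _ _ _)]
  simp only [hermiteCoeff, evalMul, eval_add, add_mul]

theorem trilinear_add_middle (b' : WeightedL2 (1 / 2)) :
    trilinear a (b + b') c = trilinear a b c + trilinear a b' c := by
  ext n
  rw [add_apply, trilinear_apply, trilinear_apply, trilinear_apply,
    ← hermiteCoeff_add (memLp_evalMul _ _ _) (memLp_evalMul _ _ _)]
  simp only [hermiteCoeff, evalMul, eval_add, star_add, add_mul, mul_add]

theorem trilinear_comm : trilinear c b a = trilinear a b c := by
  ext n
  simp only [trilinear_apply, hermiteCoeff, evalMul, mul_comm, mul_assoc]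

theorem trilinear_sub_left (a' : WeightedL2 (1 / 2)) :
    trilinear (a - a') b c = trilinear a b c - trilinear a' b c :=
  eq_sub_of_add_eq (by rw [← trilinear_add_left, sub_add_cancel])

theorem trilinear_sub_middle (b' : WeightedL2 (1 / 2)) :
    trilinear a (b - b') c = trilinear a b c - trilinear a b' c :=
  eq_sub_of_add_eq (by rw [← trilinear_add_middle, sub_add_cancel])

theorem trilinear_sub_right (c' : WeightedL2 (1 / 2)) :
    trilinear a b (c - c') = trilinear a b c - trilinear a b c' := by
  rw [trilinear_comm, trilinear_sub_left, trilinear_comm, trilinear_comm a]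

theorem summable_norm_star_mul_hermiteFun (x : ℝ) :
    Summable fun n => ‖star (b n * (hermiteFun n x : ℂ))‖ :=
  (b.summable_norm_mul_hermiteFun x).congr fun _ => (norm_star _).symm

theorem hasSum_evalMul (x : ℝ) :
    HasSum (fun m : ℕ × ℕ × ℕ => a m.1 * (hermiteFun m.1 x : ℂ) *
      (star (b m.2.1 * (hermiteFun m.2.1 x : ℂ)) * (c m.2.2 * (hermiteFun m.2.2 x : ℂ))))
      (evalMul a b c x) := by
  have hstar : ∑' n, star (b n * (hermiteFun n x : ℂ)) = star (b.eval x) :=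
    (b.hasSum_eval x).star.tsum_eq
  rw [evalMul, mul_assoc, ← hstar]
  have hsum := hasSum_mul_mul_of_summable_norm (a.summable_norm_mul_hermiteFun x)
    (b.summable_norm_star_mul_hermiteFun x) (c.summable_norm_mul_hermiteFun x)
  exact hsum

theorem sum_norm_evalMul_le (s : Finset (ℕ × ℕ × ℕ)) (x : ℝ) :
    ∑ m ∈ s, ‖a m.1 * (hermiteFun m.1 x : ℂ) *
      (star (b m.2.1 * (hermiteFun m.2.1 x : ℂ)) * (c m.2.2 * (hermiteFun m.2.2 x : ℂ)))‖ ≤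
      2 * ‖a‖ * ((2 * ‖b‖) * (2 * ‖c‖)) := by
  have hle (a : WeightedL2 (1 / 2)) : ∑' n, ‖a n * (hermiteFun n x : ℂ)‖ ≤ 2 * ‖a‖ :=
    (a.tsum_norm_mul_hermiteFun_le x).trans a.sqrt_four_mul_sqrt_mass_mul_norm_le
  grw [← hle a, ← hle b, ← hle c]
  simp only [norm_mul (_ * _ : ℂ) (_ * _), norm_mul (star _), norm_star]
  exact sum_le_hasSum s (fun m _ => by positivity) (hasSum_mul_mul_of_summable_norm
    (a.summable_norm_mul_hermiteFun x).norm (b.summable_norm_mul_hermiteFun x).norm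
    (c.summable_norm_mul_hermiteFun x).norm)

theorem hasSum_hermiteK_mul (n : ℕ) :
    HasSum (fun m : ℕ × ℕ × ℕ => (hermiteK n m.1 m.2.1 m.2.2 : ℂ) * a m.1 * star (b m.2.1) *
      c m.2.2) (trilinear a b c n) := by
  let F (m : ℕ × ℕ × ℕ) (x : ℝ) : ℂ := a m.1 * (hermiteFun m.1 x : ℂ) *
    (star (b m.2.1 * (hermiteFun m.2.1 x : ℂ)) * (c m.2.2 * (hermiteFun m.2.2 x : ℂ)))
  have hmeas (m : ℕ × ℕ × ℕ) : AEStronglyMeasurable fun x => (hermiteFun n x : ℂ) * F m x :=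
    Continuous.aestronglyMeasurable (by fun_prop)
  have hsum := hasSum_integral_of_sum_norm_le hmeas
    ((integrable_hermiteFun n).norm.mul_const (2 * ‖a‖ * ((2 * ‖b‖) * (2 * ‖c‖))))
    (fun s x => by
      simp only [norm_mul (hermiteFun n x : ℂ), Complex.norm_real, ← Finset.mul_sum]
      gcongr
      exact sum_norm_evalMul_le a b c s x)
    fun x => (hasSum_evalMul a b c x).mul_left (hermiteFun n x : ℂ)
  refine hsum.congr_fun fun m => ?_
  have hF (x : ℝ) : (hermiteFun n x : ℂ) * F m x = a m.1 * star (b m.2.1) * c m.2.2 *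
      ((hermiteFun n x * (hermiteFun m.1 x * hermiteFun m.2.1 x * hermiteFun m.2.2 x) : ℝ) :
        ℂ) := by
    simp only [F, star_mul', Complex.star_def, Complex.conj_ofReal]
    push_cast
    ring
  simp_rw [hF]
  rw [integral_const_mul, integral_complex_ofReal, hermiteK]
  ring

end WeightedL2

theorem abs_norm_add_pow_four_sub_le {E : Type*} [NormedAddCommGroup E] [InnerProductSpace ℝ E]
    (z w : E) :
    |‖z + w‖ ^ 4 - ‖z‖ ^ 4 - 4 * (‖z‖ ^ 2 * inner ℝ z w)| ≤ 6 * (‖z‖ + ‖w‖) ^ 2 * ‖w‖ ^ 2 := by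
  have hexpand : ‖z + w‖ ^ 4 - ‖z‖ ^ 4 - 4 * (‖z‖ ^ 2 * inner ℝ z w) =
      2 * ‖z‖ ^ 2 * ‖w‖ ^ 2 + (2 * inner ℝ z w + ‖w‖ ^ 2) ^ 2 := by
    linear_combination
      (‖z + w‖ ^ 2 + (‖z‖ ^ 2 + 2 * inner ℝ z w + ‖w‖ ^ 2)) * norm_add_sq_real z w
  have hcross : |2 * inner ℝ z w + ‖w‖ ^ 2| ≤ 2 * (‖z‖ * ‖w‖) + ‖w‖ ^ 2 := by
    grw [abs_add_le, abs_mul, abs_real_inner_le_norm, abs_two, abs_sq]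
  rw [hexpand, abs_of_nonneg (by positivity), ← sq_abs (_ + _)]
  grw [hcross]
  have hzw : 0 ≤ ‖z‖ * ‖w‖ ^ 3 := by positivity
  nlinarith only [hzw, sq_nonneg (‖w‖ ^ 2)]

namespace WeightedL2

variable (a : WeightedL2 (1 / 2))

/-- The functional `∫ |u|⁴` of the function `u` with coefficients `a`. -/
def quartic : ℝ := ∫ x, ‖a.eval x‖ ^ 4

theorem integrable_norm_eval_sq : Integrable fun x => ‖a.eval x‖ ^ 2 :=
  a.memLp_eval.integrable_norm_pow two_ne_zero

theorem norm_eval_pow_four_le (x : ℝ) :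
    ‖a.eval x‖ ^ 4 ≤ 4 * (√a.mass * ‖a‖) * ‖a.eval x‖ ^ 2 := by
  grw [← a.norm_eval_sq_le x]
  exact (by ring : ‖a.eval x‖ ^ 4 = ‖a.eval x‖ ^ 2 * ‖a.eval x‖ ^ 2).le

theorem integrable_norm_eval_pow_four : Integrable fun x => ‖a.eval x‖ ^ 4 :=
  (a.integrable_norm_eval_sq.const_mul (4 * (√a.mass * ‖a‖))).mono' (a.memLp_eval.1.norm.pow 4)
    (.of_forall fun x => by
      rw [Real.norm_of_nonneg (by positivity)]
      exact a.norm_eval_pow_four_le x)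

theorem quartic_nonneg : 0 ≤ a.quartic := integral_nonneg fun x => by positivity

theorem quartic_le : a.quartic ≤ 4 * (√a.mass * ‖a‖) * a.mass := by
  nth_rw 2 [← integral_norm_eval_sq]
  rw [quartic, ← integral_const_mul]
  exact integral_mono a.integrable_norm_eval_pow_four (a.integrable_norm_eval_sq.const_mul _)
    a.norm_eval_pow_four_le

theorem star_evalMul_mul (x : ℝ) (w : ℂ) :
    star (evalMul a a a x) * w = ((‖a.eval x‖ ^ 2 : ℝ) : ℂ) * (star (a.eval x) * w) := by
  rw [← Complex.normSq_eq_norm_sq, Complex.normSq_eq_conj_mul_self, ← Complex.star_def, evalMul,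
    star_mul', star_mul', star_star]
  ring

theorem hasSum_star_trilinear_mul (h : WeightedL2 (1 / 2)) :
    HasSum (fun n => star (trilinear a a a n) * h n) (∫ x, star (evalMul a a a x) * h.eval x) := by
  simpa only [hermiteCoeff_eval, trilinear_apply] using
    hasSum_star_hermiteCoeff_mul (memLp_evalMul a a a) h.memLp_eval

theorem hasSum_star_trilinear_mul_self :
    HasSum (fun n => star (trilinear a a a n) * a n) (a.quartic : ℂ) := by
  have hself (x : ℝ) : star (evalMul a a a x) * a.eval x = ((‖a.eval x‖ ^ 4 : ℝ) : ℂ) := by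
    rw [star_evalMul_mul, Complex.star_def, Complex.conj_mul']
    push_cast
    ring
  simpa only [quartic, hself, integral_complex_ofReal] using a.hasSum_star_trilinear_mul a

theorem abs_quartic_add_sub_le (h : WeightedL2 (1 / 2)) :
    |(a + h).quartic - a.quartic - 4 * (∫ x, star (evalMul a a a x) * h.eval x).re| ≤
      24 * (‖a‖ + ‖h‖) ^ 2 * h.mass := by
  have hadd := (a + h).integrable_norm_eval_pow_four
  have ha := a.integrable_norm_eval_pow_four
  have hdiff : Integrable fun x => ‖(a + h).eval x‖ ^ 4 - ‖a.eval x‖ ^ 4 := hadd.sub ha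
  have hcross : Integrable fun x => star (evalMul a a a x) * h.eval x :=
    (memLp_evalMul a a a).star.integrable_mul h.memLp_eval
  rw [← h.integral_norm_eval_sq, ← integral_const_mul, quartic, quartic,
    ← RCLike.re_eq_complex_re, ← integral_re hcross, ← integral_const_mul, ← integral_sub hadd ha,
    ← integral_sub hdiff (hcross.re.const_mul 4), ← Real.norm_eq_abs]
  refine norm_integral_le_of_norm_le (h.integrable_norm_eval_sq.const_mul _)
    (.of_forall fun x => ?_)
  have hinner : (star (evalMul a a a x) * h.eval x).re =
      ‖a.eval x‖ ^ 2 * inner ℝ (a.eval x) (h.eval x) := by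
    rw [star_evalMul_mul, Complex.re_ofReal_mul, Complex.inner, Complex.star_def,
      mul_comm (h.eval x)]
  rw [eval_add, RCLike.re_eq_complex_re, hinner, Real.norm_eq_abs]
  grw [abs_norm_add_pow_four_sub_le, a.norm_eval_le x, h.norm_eval_le x]
  exact (by ring : 6 * (2 * ‖a‖ + 2 * ‖h‖) ^ 2 * ‖h.eval x‖ ^ 2 =
    24 * (‖a‖ + ‖h‖) ^ 2 * ‖h.eval x‖ ^ 2).le

end WeightedL2

section Calculus

theorem hasDerivWithinAt_Icc_of_separating {ι E F : Type*} [NormedAddCommGroup E] [NormedSpace ℝ E]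
    [CompleteSpace E] [NormedAddCommGroup F] [NormedSpace ℝ F] [CompleteSpace F]
    {ℓ : ι → E →L[ℝ] F} (hℓ : ∀ x y, (∀ i, ℓ i x = ℓ i y) → x = y) {f f' : ℝ → E} {a b t : ℝ}
    (hf' : ContinuousOn f' (Icc a b))
    (hf : ∀ τ ∈ Icc a b, ∀ i, HasDerivWithinAt (fun u => ℓ i (f u)) (ℓ i (f' τ)) (Icc a b) τ)
    (ht : t ∈ Icc a b) : HasDerivWithinAt f (f' t) (Icc a b) t := by
  have hint {τ : ℝ} (hτ : τ ∈ Icc a b) : IntervalIntegrable f' volume a τ :=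
    (hf'.mono (uIcc_subset_Icc ⟨le_rfl, hτ.1.trans hτ.2⟩ hτ)).intervalIntegrable
  have hftc : ∀ τ ∈ Icc a b, f τ = f a + ∫ u in a..τ, f' u := fun τ hτ => by
    have hsub : Icc a τ ⊆ Icc a b := Icc_subset_Icc_right hτ.2
    refine hℓ _ _ fun i => ?_
    rw [map_add, ← (ℓ i).intervalIntegral_comp_comm (hint hτ),
      intervalIntegral.integral_eq_sub_of_hasDerivAt_of_le hτ.1
        (fun u hu => ((hf u (hsub hu) i).mono hsub).continuousWithinAt)
        (fun u hu => (hf u (hsub (Ioo_subset_Icc_self hu)) i).hasDerivAt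
          (Icc_mem_nhds hu.1 (hu.2.trans_le hτ.2)))
        (ContinuousOn.intervalIntegrable_of_Icc hτ.1
          ((ℓ i).continuous.comp_continuousOn (hf'.mono hsub))), add_sub_cancel]
  have : Fact (t ∈ Icc a b) := ⟨ht⟩
  refine HasDerivWithinAt.congr ?_ hftc (hftc t ht)
  exact (intervalIntegral.integral_hasDerivWithinAt_right (hint ht)
    (hf'.stronglyMeasurableAtFilter_nhdsWithin measurableSet_Icc t) (hf' t ht)).const_add (f a)

end Calculus

namespace WeightedL2

variable {s r : ℝ}

section Basic

/-- `toLp` as a linear isometry. -/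
def toLpₗᵢ (s : ℝ) : WeightedL2 s →ₗᵢ[ℂ] lp (fun _ : ℕ => ℂ) 2 := ⟨toLp s, fun _ => rfl⟩

theorem toLpₗᵢ_apply (a : WeightedL2 s) (n : ℕ) :
    toLpₗᵢ s a n = (((1 + n : ℝ) ^ s : ℝ) : ℂ) * a n := rfl

theorem toLpₗᵢ_surjective (s : ℝ) : Function.Surjective (toLpₗᵢ s) := fun f => by
  have hne (n : ℕ) : (((1 + n : ℝ) ^ s : ℝ) : ℂ) ≠ 0 :=
    Complex.ofReal_ne_zero.2 (Real.rpow_pos_of_pos (by positivity) s).ne'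
  have hf : weightSeq s (fun n => (((1 + n : ℝ) ^ s : ℝ) : ℂ)⁻¹ * f n) = f :=
    funext fun n => mul_inv_cancel_left₀ (hne n) _
  exact ⟨⟨_, (memWeightedL2_iff s _).2 (hf.symm ▸ f.2)⟩, Subtype.ext hf⟩

instance : CompleteSpace (WeightedL2 s) :=
  (LinearIsometryEquiv.ofSurjective (toLpₗᵢ s)
    (toLpₗᵢ_surjective s)).toIsometryEquiv.completeSpace

theorem norm_apply_le (a : WeightedL2 s) (n : ℕ) : ‖a n‖ ≤ ((1 + n : ℝ) ^ s)⁻¹ * ‖a‖ := by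
  have hpos : (0 : ℝ) < (1 + n : ℝ) ^ s := Real.rpow_pos_of_pos (by positivity) s
  have hle := lp.norm_apply_le_norm two_ne_zero (toLpₗᵢ s a) n
  rwa [toLpₗᵢ_apply, norm_mul, Complex.norm_real, Real.norm_of_nonneg hpos.le,
    LinearIsometry.norm_map, ← le_inv_mul_iff₀ hpos] at hle

/-- The coordinate functionals on `l²_s(ℕ)`. -/
def coord (s : ℝ) (n : ℕ) : WeightedL2 s →L[ℂ] ℂ :=
  LinearMap.mkContinuous ⟨⟨fun a => a n, fun _ _ => rfl⟩, fun _ _ => rfl⟩ _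
    fun a => norm_apply_le a n

theorem hasDerivWithinAt_coord {f : ℝ → WeightedL2 s} {f' : WeightedL2 s} {I : Set ℝ} {t : ℝ}
    (h : HasDerivWithinAt f f' I t) (n : ℕ) : HasDerivWithinAt (fun τ => f τ n) (f' n) I t :=
  ((coord s n).restrictScalars ℝ).hasFDerivAt.comp_hasDerivWithinAt t h

theorem hasDerivWithinAt_Icc_of_coord {f f' : ℝ → WeightedL2 s} {a b t : ℝ}
    (hf' : ContinuousOn f' (Icc a b))
    (hf : ∀ τ ∈ Icc a b, ∀ n, HasDerivWithinAt (fun u => f u n) (f' τ n) (Icc a b) τ)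
    (ht : t ∈ Icc a b) : HasDerivWithinAt f (f' t) (Icc a b) t :=
  hasDerivWithinAt_Icc_of_separating (ℓ := fun n => (coord s n).restrictScalars ℝ)
    (fun _ _ => ext) hf' hf ht

theorem hasDerivAt_of_coord {f f' : ℝ → WeightedL2 s} (hf' : Continuous f')
    (hf : ∀ t n, HasDerivAt (fun τ => f τ n) (f' t n) t) (t : ℝ) : HasDerivAt f (f' t) t :=
  (hasDerivWithinAt_Icc_of_coord (a := t - 1) (b := t + 1) hf'.continuousOn
    (fun τ _ n => (hf τ n).hasDerivWithinAt) ⟨by linarith, by linarith⟩).hasDerivAt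
    (Icc_mem_nhds (by linarith) (by linarith))

end Basic

section Multipliers

theorem weight_mul_norm_mul_sq_le {m z : ℂ} {n : ℕ} (hm : ‖m‖ ≤ (1 + n : ℝ) ^ (s - r)) :
    (1 + n : ℝ) ^ (2 * r) * ‖m * z‖ ^ 2 ≤ (1 + n : ℝ) ^ (2 * s) * ‖z‖ ^ 2 := by
  have hpos : (0 : ℝ) < 1 + n := by positivity
  have hweight : (1 + n : ℝ) ^ (2 * s) = (1 + n : ℝ) ^ (2 * r) * ((1 + n : ℝ) ^ (s - r)) ^ 2 := by
    rw [← Real.rpow_mul_natCast hpos.le, ← Real.rpow_add hpos]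
    congr 1
    push_cast
    ring
  rw [norm_mul, mul_pow, hweight, mul_assoc]
  gcongr

theorem memWeightedL2_mul {m a : ℕ → ℂ} (hm : ∀ n, ‖m n‖ ≤ (1 + n : ℝ) ^ (s - r))
    (ha : MemWeightedL2 s a) : MemWeightedL2 r fun n => m n * a n :=
  ha.of_nonneg_of_le (fun n => by positivity) fun n => weight_mul_norm_mul_sq_le (hm n)

/-- The diagonal operator `aₙ ↦ mₙ aₙ` from `l²_s` to `l²_r`, which has norm at most `1`. -/
def multiplier (m : ℕ → ℂ) (hm : ∀ n, ‖m n‖ ≤ (1 + n : ℝ) ^ (s - r)) :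
    WeightedL2 s →L[ℂ] WeightedL2 r :=
  LinearMap.mkContinuous
    { toFun a := ⟨fun n => m n * a n, memWeightedL2_mul hm a.2⟩
      map_add' a b := Subtype.ext (funext fun n => mul_add (m n) (a n) (b n))
      map_smul' c a := Subtype.ext (funext fun n => mul_left_comm (m n) c (a n)) } 1
    fun a => by
      rw [one_mul]
      refine le_of_sq_le_sq ?_ (norm_nonneg a)
      rw [norm_sq_eq, norm_sq_eq]
      exact Summable.tsum_le_tsum (fun n => weight_mul_norm_mul_sq_le (hm n))
        (memWeightedL2_mul hm a.2) a.2

/-- The inclusion `l²_{1/2}(ℕ) ⊆ l²_{-1/2}(ℕ)` as a continuous linear map. -/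
def toDual : WeightedL2 (1 / 2) →L[ℂ] WeightedL2 (-1 / 2) :=
  multiplier 1 fun n => by
    rw [Pi.one_apply, norm_one]
    exact Real.one_le_rpow (by simp) (by norm_num)

theorem toDual_apply (a : WeightedL2 (1 / 2)) (n : ℕ) : toDual a n = a n := one_mul _

theorem toDual_eq_incl (a : WeightedL2 (1 / 2)) : toDual a = incl (by norm_num) a :=
  ext a.toDual_apply

/-- The operator `aₙ ↦ n aₙ`, that is the harmonic oscillator `(-d²/dx² + x² - 1) / 2`. -/
def numberOp : WeightedL2 (1 / 2) →L[ℂ] WeightedL2 (-1 / 2) :=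
  multiplier (fun n => n) fun n => by
    norm_num [Complex.norm_natCast]

theorem numberOp_apply (a : WeightedL2 (1 / 2)) (n : ℕ) : numberOp a n = n * a n := rfl

end Multipliers

section FreeEvolution

/-- The phases `exp(-i n t)`. -/
def phase (t : ℝ) (n : ℕ) : ℂ := Complex.exp (-(n * t : ℝ) * Complex.I)

theorem norm_phase (t : ℝ) (n : ℕ) : ‖phase t n‖ = 1 := by
  rw [phase, ← Complex.ofReal_neg, Complex.norm_exp_ofReal_mul_I]

theorem star_phase_mul (t : ℝ) (n : ℕ) : star (phase t n) * phase t n = 1 := by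
  rw [Complex.star_def, Complex.conj_mul', norm_phase, Complex.ofReal_one, one_pow]

theorem phase_neg_mul (t : ℝ) (n : ℕ) : phase (-t) n * phase t n = 1 := by
  rw [phase, phase, ← Complex.exp_add, ← Complex.exp_zero]
  congr 1
  push_cast
  ring

theorem phase_zero (n : ℕ) : phase 0 n = 1 := by simp [phase]

theorem hasDerivAt_phase (t : ℝ) (n : ℕ) :
    HasDerivAt (fun τ => phase τ n) (-(Complex.I * n) * phase t n) t := by
  have hlin : HasDerivAt (fun τ : ℝ => -((n * τ : ℝ) : ℂ) * Complex.I)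
      (-((n * 1 : ℝ) : ℂ) * Complex.I) t :=
    (((hasDerivAt_id t).const_mul (n : ℝ)).ofReal_comp.neg).mul_const _
  refine hlin.cexp.congr_deriv ?_
  rw [phase]
  push_cast
  ring

theorem hasDerivAt_phase_neg (t : ℝ) (n : ℕ) :
    HasDerivAt (fun τ => phase (-τ) n) (Complex.I * n * phase (-t) n) t :=
  ((hasDerivAt_phase (-t) n).scomp t (hasDerivAt_neg t)).congr_deriv (by simp)

/-- The free evolution `aₙ ↦ exp(-i n t) aₙ`. -/
def rot (t : ℝ) : WeightedL2 s →L[ℂ] WeightedL2 s :=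
  multiplier (phase t) fun n => by rw [norm_phase, sub_self, Real.rpow_zero]

theorem rot_apply (t : ℝ) (a : WeightedL2 s) (n : ℕ) : rot t a n = phase t n * a n := rfl

theorem rot_zero (a : WeightedL2 s) : rot 0 a = a :=
  ext fun n => by rw [rot_apply, phase_zero, one_mul]

theorem norm_rot (t : ℝ) (a : WeightedL2 s) : ‖rot t a‖ = ‖a‖ := by
  rw [← sq_eq_sq₀ (norm_nonneg _) (norm_nonneg _), norm_sq_eq, norm_sq_eq]
  simp only [rot_apply, norm_mul, norm_phase, one_mul]

theorem mass_rot (t : ℝ) (a : WeightedL2 (1 / 2)) : (rot t a).mass = a.mass := by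
  simp only [mass, rot_apply, norm_mul, norm_phase, one_mul]

theorem tendsto_norm_rot_sub_sq (a : WeightedL2 s) (t : ℝ) :
    Tendsto (fun τ => ‖rot τ a - rot t a‖ ^ 2) (𝓝 t) (𝓝 0) := by
  simp only [norm_sq_eq, sub_apply, rot_apply]
  rw [← tsum_zero (α := ℝ) (β := ℕ)]
  refine tendsto_tsum_of_dominated_convergence (Summable.mul_left (2 ^ 2) a.2) (fun n => ?_)
    (.of_forall fun τ n => ?_)
  · have hphase : Tendsto (fun τ => phase τ n) (𝓝 t) (𝓝 (phase t n)) :=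
      (hasDerivAt_phase t n).continuousAt
    simpa using ((hphase.mul_const (a n)).sub_const (phase t n * a n)).norm.pow 2
      |>.const_mul ((1 + n : ℝ) ^ (2 * s))
  · have hphase : ‖phase τ n - phase t n‖ ≤ 2 :=
      (norm_sub_le _ _).trans_eq (by rw [norm_phase, norm_phase]; norm_num)
    rw [Real.norm_of_nonneg (by positivity), ← sub_mul, norm_mul, mul_pow, mul_left_comm]
    gcongr

theorem continuous_rot_left (a : WeightedL2 s) : Continuous fun t => rot t a := by
  refine continuous_iff_continuousAt.2 fun t => tendsto_iff_norm_sub_tendsto_zero.2 ?_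
  simpa only [Real.sqrt_zero, Real.sqrt_sq (norm_nonneg _)] using (tendsto_norm_rot_sub_sq a t).sqrt

theorem continuous_rot : Continuous fun p : ℝ × WeightedL2 s => rot p.1 p.2 := by
  refine continuous_prod_of_continuous_lipschitzWith' _ 1 (fun t => ?_) continuous_rot_left
  exact (AddMonoidHomClass.isometry_of_norm (rot t) (norm_rot t)).lipschitz

theorem continuous_rot_comp {X : Type*} [TopologicalSpace X] {f : X → ℝ} {g : X → WeightedL2 s}
    (hf : Continuous f) (hg : Continuous g) : Continuous fun x => rot (f x) (g x) :=
  continuous_rot.comp (f := fun x => (f x, g x)) (hf.prodMk hg)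

theorem continuousOn_rot_comp {X : Type*} [TopologicalSpace X] {f : X → ℝ} {g : X → WeightedL2 s}
    {I : Set X} (hf : ContinuousOn f I) (hg : ContinuousOn g I) :
    ContinuousOn (fun x => rot (f x) (g x)) I :=
  continuous_rot.comp_continuousOn (f := fun x => (f x, g x)) (hf.prodMk hg)

end FreeEvolution

end WeightedL2

section ODE

open scoped NNReal

variable {E : Type*} [NormedAddCommGroup E] [NormedSpace ℝ E]

theorem norm_le_mul_exp_of_norm_deriv_le {e e' : ℝ → E} {K T : ℝ} (hT : 0 ≤ T)
    (he : ∀ t ∈ Icc 0 T, HasDerivWithinAt e (e' t) (Icc 0 T) t)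
    (hle : ∀ t ∈ Icc 0 T, ‖e' t‖ ≤ K * ‖e t‖) : ‖e T‖ ≤ ‖e 0‖ * Real.exp (K * T) := by
  have hgronwall := norm_le_gronwallBound_of_norm_deriv_right_le (ε := 0)
    (fun t ht => (he t ht).continuousWithinAt)
    (fun t ht => (he t (Ico_subset_Icc_self ht)).mono_of_mem_nhdsWithin (Icc_mem_nhdsGE_of_mem ht))
    le_rfl (fun t ht => (hle t (Ico_subset_Icc_self ht)).trans_eq (add_zero _).symm) T ⟨hT, le_rfl⟩
  rwa [gronwallBound_ε0, sub_zero] at hgronwall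

theorem norm_le_mul_exp_abs_of_norm_deriv_le {e e' : ℝ → E} {K t : ℝ}
    (he : ∀ τ ∈ uIcc 0 t, HasDerivWithinAt e (e' τ) (uIcc 0 t) τ)
    (hle : ∀ τ ∈ uIcc 0 t, ‖e' τ‖ ≤ K * ‖e τ‖) : ‖e t‖ ≤ ‖e 0‖ * Real.exp (K * |t|) := by
  rcases le_total 0 t with ht | ht
  · rw [uIcc_of_le ht] at he hle
    rw [abs_of_nonneg ht]
    exact norm_le_mul_exp_of_norm_deriv_le ht he hle
  · rw [uIcc_of_ge ht] at he hle
    rw [abs_of_nonpos ht]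
    have hmap : MapsTo (fun τ : ℝ => -τ) (Icc 0 (-t)) (Icc t 0) := fun τ hτ =>
      ⟨by linarith [hτ.2], by linarith [hτ.1]⟩
    have hreflected := norm_le_mul_exp_of_norm_deriv_le (e := fun τ => e (-τ))
      (neg_nonneg.2 ht)
      (fun τ hτ => (he (-τ) (hmap hτ)).scomp τ (hasDerivAt_neg τ).hasDerivWithinAt hmap)
      (fun τ hτ => by simpa only [neg_smul, one_smul, norm_neg] using hle (-τ) (hmap hτ))
    simpa only [neg_neg, neg_zero] using hreflected

variable {f : ℝ → E → E} {B K : ℝ≥0}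

theorem eq_of_hasDerivWithinAt_of_lipschitzWith (hlip : ∀ t, LipschitzWith K (f t)) {α β : ℝ → E}
    {t : ℝ} (hα : ∀ τ ∈ uIcc 0 t, HasDerivWithinAt α (f τ (α τ)) (uIcc 0 t) τ)
    (hβ : ∀ τ ∈ uIcc 0 t, HasDerivWithinAt β (f τ (β τ)) (uIcc 0 t) τ) (h0 : α 0 = β 0) :
    α t = β t := by
  have hle := norm_le_mul_exp_abs_of_norm_deriv_le (fun τ hτ => (hα τ hτ).fun_sub (hβ τ hτ))
    (fun τ _ => (hlip τ).norm_sub_le (α τ) (β τ))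
  rw [h0, sub_self, norm_zero, zero_mul] at hle
  exact sub_eq_zero.1 (norm_le_zero_iff.1 hle)

variable [CompleteSpace E]

theorem exists_hasDerivWithinAt_Icc_of_lipschitzWith (hlip : ∀ t, LipschitzWith K (f t))
    (hcont : ∀ x, Continuous fun t => f t x) (hB : ∀ t x, ‖f t x‖ ≤ B) (x₀ : E) (T : ℝ≥0) :
    ∃ α : ℝ → E, α 0 = x₀ ∧
      ∀ t ∈ Icc (-T : ℝ) T, HasDerivWithinAt α (f t (α t)) (Icc (-T : ℝ) T) t :=
  IsPicardLindelof.exists_eq_forall_mem_Icc_hasDerivWithinAt₀ (t₀ := ⟨0, by simp⟩)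
    (a := B * T) (L := B) (K := K)
    { lipschitzOnWith t _ := (hlip t).lipschitzOnWith
      continuousOn x _ := (hcont x).continuousOn
      norm_le t _ x _ := hB t x
      mul_max_le := by simp }

theorem exists_forall_hasDerivAt_of_lipschitzWith (hlip : ∀ t, LipschitzWith K (f t))
    (hcont : ∀ x, Continuous fun t => f t x) (hB : ∀ t x, ‖f t x‖ ≤ B) (x₀ : E) :
    ∃ α : ℝ → E, α 0 = x₀ ∧ ∀ t, HasDerivAt α (f t (α t)) t := by
  choose α hα0 hα using fun N : ℕ => exists_hasDerivWithinAt_Icc_of_lipschitzWith hlip hcont hB x₀ N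
  have hsub {N : ℕ} {t : ℝ} (hN : |t| ≤ N) : uIcc 0 t ⊆ Icc (-((N : ℝ≥0) : ℝ)) ((N : ℝ≥0) : ℝ) :=
    uIcc_subset_Icc (by simp) (by simpa using abs_le.1 hN)
  have hagree {N M : ℕ} {t : ℝ} (hN : |t| ≤ N) (hM : |t| ≤ M) : α N t = α M t :=
    eq_of_hasDerivWithinAt_of_lipschitzWith hlip
      (fun τ hτ => (hα N τ (hsub hN hτ)).mono (hsub hN))
      (fun τ hτ => (hα M τ (hsub hM hτ)).mono (hsub hM)) ((hα0 N).trans (hα0 M).symm)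
  refine ⟨fun t => α ⌈|t|⌉₊ t, hα0 _, fun t => ?_⟩
  obtain ⟨N, hN⟩ := exists_nat_gt |t|
  have hlocal : (fun τ => α ⌈|τ|⌉₊ τ) =ᶠ[𝓝 t] α N := by
    filter_upwards [continuous_abs.continuousAt.eventually_lt_const hN] with τ hτ
    exact hagree (Nat.le_ceil _) hτ.le
  have hnhds : Icc (-((N : ℝ≥0) : ℝ)) ((N : ℝ≥0) : ℝ) ∈ 𝓝 t :=
    Icc_mem_nhds (abs_lt.1 hN).1 (abs_lt.1 hN).2
  refine HasDerivAt.congr_deriv ?_ (congrArg (f t) (hagree hN.le (Nat.le_ceil |t|)))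
  exact ((hα N t (mem_of_mem_nhds hnhds)).hasDerivAt hnhds).congr_of_eventuallyEq hlocal

end ODE

namespace WeightedL2

open scoped NNReal

variable {s : ℝ} {F : WeightedL2 s → WeightedL2 s} {I : Set ℝ}

/-- Solutions on `I` of `i ȧₙ = n aₙ + F(a)ₙ`, `n = 0, 1, 2, …`, that are continuous in `l²_s`. -/
def IsSemilinearSol (F : WeightedL2 s → WeightedL2 s) (I : Set ℝ) (a : ℝ → WeightedL2 s) : Prop :=
  ContinuousOn a I ∧ ∀ t ∈ I, ∀ n : ℕ,
    HasDerivWithinAt (fun τ => a τ n) (-(Complex.I * (n * a t n + F (a t) n))) I t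

theorem IsSemilinearSol.mono {a : ℝ → WeightedL2 s} {J : Set ℝ} (h : IsSemilinearSol F I a)
    (hJ : J ⊆ I) : IsSemilinearSol F J a :=
  ⟨h.1.mono hJ, fun t ht n => (h.2 t (hJ ht) n).mono hJ⟩

theorem hasDerivWithinAt_rot_neg_apply {e : ℝ → WeightedL2 s} {g : WeightedL2 s} {t : ℝ} {n : ℕ}
    (h : HasDerivWithinAt (fun τ => e τ n) (-(Complex.I * (n * e t n + g n))) I t) :
    HasDerivWithinAt (fun τ => rot (-τ) (e τ) n) (rot (-t) (-Complex.I • g) n) I t := by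
  refine ((hasDerivAt_phase_neg t n).hasDerivWithinAt.fun_mul h).congr_deriv ?_
  rw [rot_apply, smul_apply]
  ring

theorem hasDerivWithinAt_rot_apply {e : ℝ → WeightedL2 s} {g : WeightedL2 s} {t : ℝ} {n : ℕ}
    (h : HasDerivWithinAt (fun τ => e τ n) (rot (-t) (-Complex.I • g) n) I t) :
    HasDerivWithinAt (fun τ => rot τ (e τ) n) (-(Complex.I * (n * rot t (e t) n + g n))) I t := by
  refine ((hasDerivAt_phase t n).hasDerivWithinAt.fun_mul h).congr_deriv ?_
  rw [rot_apply, smul_apply, rot_apply]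
  linear_combination (-Complex.I * g n) * phase_neg_mul t n

theorem norm_rot_neg_I_smul (t : ℝ) (g : WeightedL2 s) : ‖rot t (-Complex.I • g)‖ = ‖g‖ := by
  rw [norm_rot, norm_smul, norm_neg, Complex.norm_I, one_mul]

theorem IsSemilinearSol.hasDerivWithinAt_rot_neg (hF : Continuous F) {a : ℝ → WeightedL2 s}
    {x y t : ℝ} (ha : IsSemilinearSol F (Icc x y) a) (ht : t ∈ Icc x y) :
    HasDerivWithinAt (fun τ => rot (-τ) (a τ)) (rot (-t) (-Complex.I • F (a t))) (Icc x y) t :=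
  hasDerivWithinAt_Icc_of_coord (f' := fun τ => rot (-τ) (-Complex.I • F (a τ)))
    (continuousOn_rot_comp continuousOn_neg ((hF.comp_continuousOn ha.1).const_smul (-Complex.I)))
    (fun τ hτ n => hasDerivWithinAt_rot_neg_apply (ha.2 τ hτ n)) ht

theorem IsSemilinearSol.norm_sub_le (hF : Continuous F) {a b : ℝ → WeightedL2 s} {t K : ℝ}
    (ha : IsSemilinearSol F (uIcc 0 t) a) (hb : IsSemilinearSol F (uIcc 0 t) b)
    (hK : ∀ τ ∈ uIcc 0 t, ‖F (a τ) - F (b τ)‖ ≤ K * ‖a τ - b τ‖) :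
    ‖a t - b t‖ ≤ ‖a 0 - b 0‖ * Real.exp (K * |t|) := by
  have hderiv : ∀ τ ∈ uIcc 0 t, HasDerivWithinAt (fun τ => rot (-τ) (a τ - b τ))
      (rot (-τ) (-Complex.I • (F (a τ) - F (b τ)))) (uIcc 0 t) τ := fun τ hτ => by
    simp only [map_sub, smul_sub]
    exact (ha.hasDerivWithinAt_rot_neg hF hτ).fun_sub (hb.hasDerivWithinAt_rot_neg hF hτ)
  have hgronwall := norm_le_mul_exp_abs_of_norm_deriv_le hderiv fun τ hτ => by
    rw [norm_rot_neg_I_smul, norm_rot]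
    exact hK τ hτ
  simpa only [norm_rot] using hgronwall

-- In the interaction picture `b(t) = exp(i n t) a(t)` the unbounded operator disappears.
theorem exists_isSemilinearSol {B K : ℝ≥0} (hB : ∀ a, ‖F a‖ ≤ B) (hK : LipschitzWith K F)
    (a₀ : WeightedL2 s) : ∃ a : ℝ → WeightedL2 s, a 0 = a₀ ∧ IsSemilinearSol F univ a := by
  have hlip (t : ℝ) : LipschitzWith K fun b => rot (-t) (-Complex.I • F (rot t b)) :=
    LipschitzWith.of_dist_le_mul fun x y => by
      have hle := hK.norm_sub_le (rot t x) (rot t y)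
      rw [← map_sub, norm_rot] at hle
      rwa [dist_eq_norm, dist_eq_norm, ← map_sub, ← smul_sub, norm_rot_neg_I_smul]
  obtain ⟨b, hb0, hb⟩ := exists_forall_hasDerivAt_of_lipschitzWith hlip
    (fun x => continuous_rot_comp continuous_neg
      ((hK.continuous.comp (continuous_rot_left x)).const_smul (-Complex.I)))
    (fun t x => (norm_rot_neg_I_smul (-t) (F (rot t x))).trans_le (hB _)) a₀
  have hcont : Continuous b := continuous_iff_continuousAt.2 fun t => (hb t).continuousAt
  refine ⟨fun t => rot t (b t), (rot_zero _).trans hb0,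
    (continuous_rot_comp continuous_id hcont).continuousOn, fun t _ n => ?_⟩
  exact hasDerivWithinAt_rot_apply (hasDerivWithinAt_coord (hb t).hasDerivWithinAt n)

end WeightedL2

theorem hasDerivAt_of_isLittleO_sub {E : Type*} [NormedAddCommGroup E] [NormedSpace ℝ E]
    {f g : ℝ → E} {g' : E} {t : ℝ} (hg : HasDerivAt g g' t)
    (hfg : (fun τ => f τ - f t - (g τ - g t)) =o[𝓝 t] fun τ => τ - t) : HasDerivAt f g' t :=
  hasDerivAt_iff_isLittleO.2 <|
    (hfg.add (hasDerivAt_iff_isLittleO.1 hg)).congr_left fun _ => sub_add_sub_cancel _ _ _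

namespace WeightedL2

variable {s r : ℝ}

section Pairing

/-- The pairing `∑ (1 + n)^(s + r) āₙ bₙ` of `l²_s` and `l²_r`: the inner product for `s = r`, and
the duality pairing for `s + r = 0`. -/
def pairing (a : WeightedL2 s) (b : WeightedL2 r) : ℂ := inner ℂ (toLpₗᵢ s a) (toLpₗᵢ r b)

theorem hasSum_pairing (a : WeightedL2 s) (b : WeightedL2 r) :
    HasSum (fun n : ℕ => (((1 + n : ℝ) ^ (s + r) : ℝ) : ℂ) * (star (a n) * b n)) (pairing a b) := by
  refine (lp.hasSum_inner (𝕜 := ℂ) (toLpₗᵢ s a) (toLpₗᵢ r b)).congr_fun fun n => ?_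
  rw [toLpₗᵢ_apply, toLpₗᵢ_apply, RCLike.inner_apply, map_mul, Complex.conj_ofReal,
    Real.rpow_add (by positivity), Complex.star_def]
  push_cast
  ring

theorem hasSum_pairing_half (a b : WeightedL2 (1 / 2)) :
    HasSum (fun n : ℕ => (1 + n : ℂ) * (star (a n) * b n)) (pairing a b) := by
  simpa only [add_halves, Real.rpow_one, Complex.ofReal_add, Complex.ofReal_one,
    Complex.ofReal_natCast] using hasSum_pairing a b

theorem hasSum_pairing_dual (a : WeightedL2 (1 / 2)) (b : WeightedL2 (-1 / 2)) :
    HasSum (fun n : ℕ => star (a n) * b n) (pairing a b) := by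
  have hexp : (1 / 2 + -1 / 2 : ℝ) = 0 := by norm_num
  simpa only [hexp, Real.rpow_zero, Complex.ofReal_one, one_mul] using hasSum_pairing a b

theorem norm_pairing_le (a : WeightedL2 s) (b : WeightedL2 r) : ‖pairing a b‖ ≤ ‖a‖ * ‖b‖ :=
  norm_inner_le_norm (𝕜 := ℂ) (toLpₗᵢ s a) (toLpₗᵢ r b)

theorem star_pairing (a : WeightedL2 s) (b : WeightedL2 r) : star (pairing a b) = pairing b a :=
  inner_conj_symm _ _

theorem pairing_add_right (a : WeightedL2 s) (b c : WeightedL2 r) :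
    pairing a (b + c) = pairing a b + pairing a c := by
  rw [pairing, map_add, inner_add_right, pairing, pairing]

theorem pairing_sub_right (a : WeightedL2 s) (b c : WeightedL2 r) :
    pairing a (b - c) = pairing a b - pairing a c := by
  rw [pairing, map_sub, inner_sub_right, pairing, pairing]

theorem pairing_smul_right (a : WeightedL2 s) (c : ℂ) (b : WeightedL2 r) :
    pairing a (c • b) = c * pairing a b := by
  rw [pairing, map_smul, inner_smul_right, pairing]

theorem pairing_rot_rot (t : ℝ) (a : WeightedL2 s) (b : WeightedL2 r) :
    pairing (rot t a) (rot t b) = pairing a b := by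
  refine (hasSum_pairing _ _).unique ((hasSum_pairing a b).congr_fun fun n => ?_)
  rw [rot_apply, rot_apply, star_mul']
  linear_combination
    ((((1 + n : ℝ) ^ (s + r) : ℝ) : ℂ) * (star (a n) * b n)) * star_phase_mul t n

theorem hasDerivAt_re_pairing {e : ℝ → WeightedL2 s} {e' : WeightedL2 s} {g : ℝ → WeightedL2 r}
    {g' : WeightedL2 r} {t : ℝ} (he : HasDerivAt e e' t) (hg : HasDerivAt g g' t) :
    HasDerivAt (fun τ => (pairing (e τ) (g τ)).re)
      (pairing (e t) g' + pairing e' (g t)).re t := by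
  have htoLp {s : ℝ} {e : ℝ → WeightedL2 s} {e' : WeightedL2 s} (he : HasDerivAt e e' t) :
      HasDerivAt (fun τ => toLpₗᵢ s (e τ)) (toLpₗᵢ s e') t :=
    ((toLpₗᵢ s).toContinuousLinearMap.restrictScalars ℝ).hasFDerivAt.comp_hasDerivAt t he
  exact Complex.reCLM.hasFDerivAt.comp_hasDerivAt t ((htoLp he).inner ℂ (htoLp hg))

theorem hasDerivAt_norm_sq {e : ℝ → WeightedL2 s} {e' : WeightedL2 s} {t : ℝ}
    (he : HasDerivAt e e' t) :
    HasDerivAt (fun τ => ‖e τ‖ ^ 2) (2 * (pairing (e t) e').re) t := by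
  have hnorm (a : WeightedL2 s) : ‖a‖ ^ 2 = (pairing a a).re :=
    norm_sq_eq_re_inner (𝕜 := ℂ) (toLpₗᵢ s a)
  simp_rw [hnorm]
  refine (hasDerivAt_re_pairing he he).congr_deriv ?_
  rw [← star_pairing (e t) e', Complex.add_re, Complex.star_def, Complex.conj_re, two_mul]

theorem toDual_rot (t : ℝ) (a : WeightedL2 (1 / 2)) : toDual (rot t a) = rot t (toDual a) :=
  ext fun n => by rw [toDual_apply, rot_apply, rot_apply, toDual_apply]

theorem star_pairing_toDual (a b : WeightedL2 (1 / 2)) :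
    star (pairing a (toDual b)) = pairing b (toDual a) := by
  refine (hasSum_pairing_dual a (toDual b)).star.unique
    ((hasSum_pairing_dual b (toDual a)).congr_fun fun n => ?_)
  rw [toDual_apply, toDual_apply, star_mul', star_star, mul_comm]

theorem pairing_toDual_self (a : WeightedL2 (1 / 2)) : pairing a (toDual a) = (a.mass : ℂ) := by
  refine (hasSum_pairing_dual a (toDual a)).unique ?_
  refine (Complex.hasSum_ofReal.2 a.summable_norm_sq.hasSum).congr_fun fun n => ?_
  rw [toDual_apply, Complex.star_def, Complex.conj_mul', Complex.ofReal_pow]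

theorem mass_le_norm_mul_norm_toDual (a : WeightedL2 (1 / 2)) : a.mass ≤ ‖a‖ * ‖toDual a‖ := by
  rw [← Complex.ofReal_re a.mass, ← pairing_toDual_self]
  exact (Complex.re_le_norm _).trans (norm_pairing_le _ _)

theorem hasDerivAt_toDual {e : ℝ → WeightedL2 (1 / 2)} {e' : WeightedL2 (1 / 2)} {t : ℝ}
    (he : HasDerivAt e e' t) : HasDerivAt (fun τ => toDual (e τ)) (toDual e') t :=
  (toDual.restrictScalars ℝ).hasFDerivAt.comp_hasDerivAt t he

theorem hasDerivAt_mass {e : ℝ → WeightedL2 (1 / 2)} {e' : WeightedL2 (1 / 2)} {t : ℝ}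
    (he : HasDerivAt e e' t) :
    HasDerivAt (fun τ => (e τ).mass) (2 * (pairing (e t) (toDual e')).re) t := by
  have hmass (a : WeightedL2 (1 / 2)) : a.mass = (pairing a (toDual a)).re := by
    rw [pairing_toDual_self, Complex.ofReal_re]
  simp_rw [hmass]
  refine (hasDerivAt_re_pairing he (hasDerivAt_toDual he)).congr_deriv ?_
  rw [← star_pairing_toDual (e t) e', Complex.add_re, Complex.star_def, Complex.conj_re, two_mul]

end Pairing

section Quartic

/-- The cubic nonlinearity `u ↦ |u|² u` in Hermite coefficients. -/
def cubic (a : WeightedL2 (1 / 2)) : WeightedL2 (1 / 2) := trilinear a a a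

theorem pairing_cubic_toDual_self (a : WeightedL2 (1 / 2)) :
    pairing (cubic a) (toDual a) = (a.quartic : ℂ) :=
  (hasSum_pairing_dual (cubic a) (toDual a)).unique <|
    (hasSum_star_trilinear_mul_self a).congr_fun fun n => by rw [toDual_apply, cubic]

theorem abs_quartic_sub_le (a b : WeightedL2 (1 / 2)) :
    |b.quartic - a.quartic - 4 * (pairing (cubic a) (toDual (b - a))).re| ≤
      24 * (‖a‖ + ‖b - a‖) ^ 2 * ‖b - a‖ * ‖toDual (b - a)‖ := by
  have hpairing : HasSum (fun n => star (trilinear a a a n) * (b - a) n)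
      (pairing (cubic a) (toDual (b - a))) :=
    (hasSum_pairing_dual (cubic a) (toDual (b - a))).congr_fun fun n => by rw [toDual_apply, cubic]
  have hle := abs_quartic_add_sub_le a (b - a)
  rw [add_sub_cancel, (hasSum_star_trilinear_mul a (b - a)).unique hpairing] at hle
  grw [hle, mass_le_norm_mul_norm_toDual (b - a), ← mul_assoc]

theorem isLittleO_quartic_sub {a : ℝ → WeightedL2 (1 / 2)} {t : ℝ} (ha : ContinuousAt a t)
    (hd : DifferentiableAt ℝ (fun τ => toDual (a τ)) t) :
    (fun τ => (a τ).quartic - (a t).quartic - 4 * (pairing (cubic (a t)) (toDual (a τ - a t))).re)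
      =o[𝓝 t] fun τ => τ - t := by
  have hdual : (fun τ => ‖toDual (a τ - a t)‖) =O[𝓝 t] fun τ => τ - t := by
    simpa only [map_sub] using hd.hasDerivAt.isBigO_sub.norm_left
  have hfactor : (fun τ => 24 * (‖a t‖ + ‖a τ - a t‖) ^ 2 * ‖a τ - a t‖) =o[𝓝 t]
      fun _ => (1 : ℝ) := by
    have hlim : Tendsto (fun τ => ‖a τ - a t‖) (𝓝 t) (𝓝 0) :=
      tendsto_iff_norm_sub_tendsto_zero.1 ha
    rw [Asymptotics.isLittleO_one_iff]
    simpa using (((hlim.const_add ‖a t‖).pow 2).const_mul 24).mul hlim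
  have hprod := hfactor.mul_isBigO hdual
  simp only [one_mul] at hprod
  exact (Asymptotics.IsBigO.of_norm_le fun τ => abs_quartic_sub_le (a t) (a τ)).trans_isLittleO
    hprod

-- The curve need only be differentiable in `l²_{-1/2}`: the remainder is controlled by the mass,
-- hence by `‖h‖_{1/2} ‖h‖_{-1/2}`.
theorem hasDerivAt_quartic {a : ℝ → WeightedL2 (1 / 2)} {a' : WeightedL2 (-1 / 2)} {t : ℝ}
    (ha : ContinuousAt a t) (hd : HasDerivAt (fun τ => toDual (a τ)) a' t) :
    HasDerivAt (fun τ => (a τ).quartic) (4 * (pairing (cubic (a t)) a').re) t := by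
  have hlin : HasDerivAt (fun τ => 4 * (pairing (cubic (a t)) (toDual (a τ))).re)
      (4 * (pairing (cubic (a t)) a').re) t :=
    ((hasDerivAt_re_pairing (hasDerivAt_const t (cubic (a t))) hd).congr_deriv
      (by simp [pairing])).const_mul 4
  refine hasDerivAt_of_isLittleO_sub hlin
    ((isLittleO_quartic_sub ha hd.differentiableAt).congr_left fun τ => ?_)
  rw [map_sub, pairing_sub_right, Complex.sub_re, mul_sub]

end Quartic

section Conservation

/-- The velocity `-i (n aₙ + Fₙ)`, which lies in `l²_{-1/2}` only. -/
def velocity (a F : WeightedL2 (1 / 2)) : WeightedL2 (-1 / 2) :=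
  -Complex.I • (numberOp a + toDual F)

theorem velocity_apply (a F : WeightedL2 (1 / 2)) (n : ℕ) :
    velocity a F n = -(Complex.I * (n * a n + F n)) := by
  rw [velocity, smul_apply, add_apply, numberOp_apply, toDual_apply, neg_mul]

namespace IsSemilinearSol

variable {F : WeightedL2 (1 / 2) → WeightedL2 (1 / 2)} {a : ℝ → WeightedL2 (1 / 2)}

theorem continuous (ha : IsSemilinearSol F univ a) : Continuous a := continuousOn_univ.1 ha.1

theorem continuous_velocity (hF : Continuous F) (ha : IsSemilinearSol F univ a) :
    Continuous fun t => velocity (a t) (F (a t)) :=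
  ((numberOp.continuous.comp ha.continuous).add
    (toDual.continuous.comp (hF.comp ha.continuous))).const_smul (-Complex.I)

theorem hasDerivAt_toDual (hF : Continuous F) (ha : IsSemilinearSol F univ a) (t : ℝ) :
    HasDerivAt (fun τ => toDual (a τ)) (velocity (a t) (F (a t))) t := by
  refine hasDerivAt_of_coord (ha.continuous_velocity hF) (fun τ n => ?_) t
  simp only [velocity_apply, toDual_apply]
  exact (ha.2 τ (mem_univ τ) n).hasDerivAt univ_mem

theorem hasDerivAt_rot_neg (hF : Continuous F) (ha : IsSemilinearSol F univ a) (t : ℝ) :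
    HasDerivAt (fun τ => rot (-τ) (a τ)) (rot (-t) (-Complex.I • F (a t))) t :=
  ((ha.mono (subset_univ (Icc (t - 1) (t + 1)))).hasDerivWithinAt_rot_neg hF
    ⟨by linarith, by linarith⟩).hasDerivAt (Icc_mem_nhds (by linarith) (by linarith))

theorem hasDerivAt_norm_sq (hF : Continuous F) (ha : IsSemilinearSol F univ a) (t : ℝ) :
    HasDerivAt (fun τ => ‖a τ‖ ^ 2) (2 * (pairing (a t) (-Complex.I • F (a t))).re) t := by
  simpa only [norm_rot, pairing_rot_rot] using
    WeightedL2.hasDerivAt_norm_sq (ha.hasDerivAt_rot_neg hF t)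

theorem hasDerivAt_mass (hF : Continuous F) (ha : IsSemilinearSol F univ a) (t : ℝ) :
    HasDerivAt (fun τ => (a τ).mass)
      (2 * (pairing (a t) (toDual (-Complex.I • F (a t)))).re) t := by
  simpa only [mass_rot, toDual_rot, pairing_rot_rot] using
    WeightedL2.hasDerivAt_mass (ha.hasDerivAt_rot_neg hF t)

end IsSemilinearSol

/-- The conserved energy, equal to twice the Hamiltonian plus the mass. -/
def energy (σ : ℝ) (a : WeightedL2 (1 / 2)) : ℝ := ‖a‖ ^ 2 + σ / 2 * a.quartic

theorem IsSemilinearSol.hasDerivAt_energy {F : WeightedL2 (1 / 2) → WeightedL2 (1 / 2)}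
    (hF : Continuous F) {a : ℝ → WeightedL2 (1 / 2)} (ha : IsSemilinearSol F univ a) (σ t : ℝ) :
    HasDerivAt (fun τ => energy σ (a τ))
      (2 * (pairing (a t) (-Complex.I • F (a t))).re +
        σ / 2 * (4 * (pairing (cubic (a t)) (velocity (a t) (F (a t)))).re)) t :=
  (ha.hasDerivAt_norm_sq hF t).add ((hasDerivAt_quartic ha.continuous.continuousAt
    (ha.hasDerivAt_toDual hF t)).const_mul (σ / 2))

/-- The nonlinearity `σ |u|² u` in Hermite coefficients. -/
def nonlin (σ : ℝ) (a : WeightedL2 (1 / 2)) : WeightedL2 (1 / 2) := (σ : ℂ) • cubic a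

theorem re_pairing_toDual_nonlin (σ : ℝ) (a : WeightedL2 (1 / 2)) :
    (pairing a (toDual (-Complex.I • nonlin σ a))).re = 0 := by
  rw [nonlin, map_smul, map_smul, pairing_smul_right, pairing_smul_right, ← star_pairing_toDual,
    pairing_cubic_toDual_self]
  simp

theorem pairing_numberOp (b a : WeightedL2 (1 / 2)) :
    pairing b (numberOp a) = pairing b a - pairing b (toDual a) := by
  refine (hasSum_pairing_dual b (numberOp a)).unique
    (((hasSum_pairing_half b a).sub (hasSum_pairing_dual b (toDual a))).congr_fun fun n => ?_)
  rw [numberOp_apply, toDual_apply]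
  ring

theorem pairing_cubic_velocity_nonlin (σ : ℝ) (a : WeightedL2 (1 / 2)) :
    pairing (cubic a) (velocity a (nonlin σ a)) =
      -Complex.I * (pairing (cubic a) a - a.quartic + σ * (cubic a).mass) := by
  rw [velocity, pairing_smul_right, pairing_add_right, pairing_numberOp, pairing_cubic_toDual_self,
    nonlin, map_smul, pairing_smul_right, pairing_toDual_self]

theorem energy_balance (σ : ℝ) (a : WeightedL2 (1 / 2)) :
    2 * (pairing a (-Complex.I • nonlin σ a)).re +
      σ / 2 * (4 * (pairing (cubic a) (velocity a (nonlin σ a))).re) = 0 := by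
  have hre (z : ℂ) : (-Complex.I * z).re = z.im := by simp
  rw [pairing_cubic_velocity_nonlin, nonlin, pairing_smul_right, pairing_smul_right,
    ← star_pairing (cubic a) a, hre, hre]
  simp only [Complex.star_def, Complex.im_ofReal_mul, Complex.conj_im, Complex.add_im,
    Complex.sub_im, Complex.ofReal_im]
  ring

end Conservation

end WeightedL2

section Truncation

open scoped NNReal

variable {E G : Type*} [NormedAddCommGroup E] [NormedAddCommGroup G] [NormedSpace ℝ G]

/-- The continuous cutoff equal to `1` for `r ≤ M`, to `0` for `r ≥ M + 1`, and affine in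
between. -/
def cutoff (M r : ℝ) : ℝ := max 0 (min 1 (M + 1 - r))

theorem cutoff_nonneg (M r : ℝ) : 0 ≤ cutoff M r := le_max_left _ _

theorem cutoff_le_one (M r : ℝ) : cutoff M r ≤ 1 := max_le zero_le_one (min_le_left _ _)

theorem cutoff_of_le {M r : ℝ} (h : r ≤ M) : cutoff M r = 1 := by
  rw [cutoff, min_eq_left (by linarith), max_eq_right zero_le_one]

theorem cutoff_of_ge {M r : ℝ} (h : M + 1 ≤ r) : cutoff M r = 0 := by
  rw [cutoff, min_eq_right (by linarith), max_eq_left (by linarith)]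

theorem abs_cutoff_sub_le (M r r' : ℝ) : |cutoff M r - cutoff M r'| ≤ |r - r'| := by
  have hlip : LipschitzWith 1 (cutoff M) :=
    ((LipschitzWith.of_dist_le_mul fun x y => by
      rw [NNReal.coe_one, one_mul, dist_sub_left]).const_min 1).const_max 0
  simpa only [NNReal.coe_one, one_mul, Real.norm_eq_abs] using hlip.norm_sub_le r r'

/-- The map `F` multiplied by a cutoff that is supported in the ball of radius `M + 1`. -/
def truncate (M : ℝ) (F : E → G) (a : E) : G := cutoff M ‖a‖ • F a

theorem truncate_of_norm_le {M : ℝ} (F : E → G) {a : E} (h : ‖a‖ ≤ M) : truncate M F a = F a := by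
  rw [truncate, cutoff_of_le h, one_smul]

theorem truncate_of_le_norm {M : ℝ} (F : E → G) {a : E} (h : M + 1 ≤ ‖a‖) :
    truncate M F a = 0 := by
  rw [truncate, cutoff_of_ge h, zero_smul]

theorem norm_cutoff_smul_le (M r : ℝ) (x : G) : ‖cutoff M r • x‖ ≤ ‖x‖ := by
  rw [norm_smul, Real.norm_of_nonneg (cutoff_nonneg M r)]
  exact mul_le_of_le_one_left (norm_nonneg x) (cutoff_le_one M r)

variable {M : ℝ} {F : E → G} {B K : ℝ≥0}

theorem norm_truncate_le (hB : ∀ a, ‖a‖ ≤ M + 1 → ‖F a‖ ≤ B) (a : E) : ‖truncate M F a‖ ≤ B := by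
  rcases le_total ‖a‖ (M + 1) with ha | ha
  · exact (norm_cutoff_smul_le M ‖a‖ (F a)).trans (hB a ha)
  · rw [truncate_of_le_norm F ha, norm_zero]
    exact B.2

theorem norm_truncate_sub_le_of_norm_le (hB : ∀ a, ‖a‖ ≤ M + 1 → ‖F a‖ ≤ B)
    (hK : LipschitzOnWith K F (Metric.closedBall 0 (M + 1))) (a : E) {b : E} (hb : ‖b‖ ≤ M + 1) :
    ‖truncate M F a - truncate M F b‖ ≤ (K + B) * ‖a - b‖ := by
  have hdecomp : truncate M F a - truncate M F b =
      cutoff M ‖a‖ • (F a - F b) + (cutoff M ‖a‖ - cutoff M ‖b‖) • F b := by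
    rw [truncate, truncate, smul_sub, sub_smul]
    abel
  have hleft : ‖cutoff M ‖a‖ • (F a - F b)‖ ≤ K * ‖a - b‖ := by
    rcases le_total ‖a‖ (M + 1) with ha | ha
    · exact (norm_cutoff_smul_le M ‖a‖ _).trans
        (hK.norm_sub_le (mem_closedBall_zero_iff.2 ha) (mem_closedBall_zero_iff.2 hb))
    · rw [cutoff_of_ge ha, zero_smul, norm_zero]
      positivity
  have hright : ‖(cutoff M ‖a‖ - cutoff M ‖b‖) • F b‖ ≤ B * ‖a - b‖ := by
    rw [norm_smul, Real.norm_eq_abs, mul_comm]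
    grw [hB b hb, abs_cutoff_sub_le, abs_norm_sub_norm_le]
  rw [hdecomp, add_mul]
  exact norm_add_le_of_le hleft hright

theorem lipschitzWith_truncate (hB : ∀ a, ‖a‖ ≤ M + 1 → ‖F a‖ ≤ B)
    (hK : LipschitzOnWith K F (Metric.closedBall 0 (M + 1))) :
    LipschitzWith (K + B) (truncate M F) := by
  refine LipschitzWith.of_dist_le_mul fun a b => ?_
  rw [dist_eq_norm, dist_eq_norm]
  rcases le_total ‖b‖ (M + 1) with hb | hb
  · exact norm_truncate_sub_le_of_norm_le hB hK a hb
  rcases le_total ‖a‖ (M + 1) with ha | ha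
  · rw [norm_sub_rev, norm_sub_rev a]
    exact norm_truncate_sub_le_of_norm_le hB hK b ha
  · rw [truncate_of_le_norm F ha, truncate_of_le_norm F hb, sub_zero, norm_zero]
    positivity

end Truncation

theorem eq_of_hasDerivAt_of_eventually_eq_zero {E : Type*} [NormedAddCommGroup E] [NormedSpace ℝ E]
    {f f' : ℝ → E} {t₀ : ℝ} (hf : ∀ t, HasDerivAt f (f' t) t)
    (hzero : ∀ s, f s = f t₀ → ∀ᶠ t in 𝓝 s, f' t = 0) (t : ℝ) : f t = f t₀ := by
  have hcont : Continuous f := continuous_iff_continuousAt.2 fun t => (hf t).continuousAt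
  have hclosed : IsClosed {t | f t = f t₀} := isClosed_eq hcont continuous_const
  have hopen : IsOpen {t | f t = f t₀} := by
    refine Metric.isOpen_iff.2 fun s hs => ?_
    obtain ⟨r, hr, hball⟩ := Metric.eventually_nhds_iff_ball.1 (hzero s hs)
    refine ⟨r, hr, fun τ hτ => Eq.trans ?_ hs⟩
    exact Metric.isOpen_ball.is_const_of_deriv_eq_zero (convex_ball s r).isPreconnected
      (fun x _ => (hf x).differentiableAt.differentiableWithinAt)
      (fun x hx => (hf x).deriv.trans (hball x hx)) hτ (Metric.mem_ball_self hr)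
  exact eq_univ_iff_forall.1 (IsClopen.eq_univ ⟨hclosed, hopen⟩ ⟨t₀, rfl⟩) t

namespace WeightedL2

section Nonlinearity

open scoped NNReal

theorem norm_cubic_le (a : WeightedL2 (1 / 2)) : ‖cubic a‖ ≤ 16 * ‖a‖ ^ 3 :=
  (norm_trilinear_le a a a).trans_eq (by ring)

theorem norm_cubic_sub_le {a b : WeightedL2 (1 / 2)} {R : ℝ} (ha : ‖a‖ ≤ R) (hb : ‖b‖ ≤ R) :
    ‖cubic a - cubic b‖ ≤ 48 * R ^ 2 * ‖a - b‖ := by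
  have hR : 0 ≤ R := (norm_nonneg a).trans ha
  calc ‖cubic a - cubic b‖
      = ‖trilinear (a - b) a a + trilinear b (a - b) a + trilinear b b (a - b)‖ := by
        rw [trilinear_sub_left, trilinear_sub_middle, trilinear_sub_right, cubic, cubic]
        congr 1
        abel
    _ ≤ 16 * ‖a - b‖ * ‖a‖ * ‖a‖ + 16 * ‖b‖ * ‖a - b‖ * ‖a‖ + 16 * ‖b‖ * ‖b‖ * ‖a - b‖ :=
        norm_add_le_of_le (norm_add_le_of_le (norm_trilinear_le _ _ _) (norm_trilinear_le _ _ _))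
          (norm_trilinear_le _ _ _)
    _ ≤ 16 * ‖a - b‖ * R * R + 16 * R * ‖a - b‖ * R + 16 * R * R * ‖a - b‖ := by gcongr
    _ = 48 * R ^ 2 * ‖a - b‖ := by ring

theorem norm_nonlin_le (σ : ℝ) {a : WeightedL2 (1 / 2)} {R : ℝ} (h : ‖a‖ ≤ R) :
    ‖nonlin σ a‖ ≤ |σ| * (16 * R ^ 3) := by
  rw [nonlin, norm_smul, Complex.norm_real, Real.norm_eq_abs]
  grw [norm_cubic_le, h]

theorem norm_nonlin_sub_le (σ : ℝ) {a b : WeightedL2 (1 / 2)} {R : ℝ} (ha : ‖a‖ ≤ R)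
    (hb : ‖b‖ ≤ R) : ‖nonlin σ a - nonlin σ b‖ ≤ |σ| * (48 * R ^ 2) * ‖a - b‖ := by
  rw [nonlin, nonlin, ← smul_sub, norm_smul, Complex.norm_real, Real.norm_eq_abs, mul_assoc]
  exact mul_le_mul_of_nonneg_left (norm_cubic_sub_le ha hb) (abs_nonneg σ)

theorem lipschitzOnWith_nonlin (σ R : ℝ) :
    LipschitzOnWith (|σ| * (48 * R ^ 2)).toNNReal (nonlin σ) (Metric.closedBall 0 R) :=
  LipschitzOnWith.of_dist_le_mul fun a ha b hb => by
    rw [dist_eq_norm, dist_eq_norm, Real.coe_toNNReal _ (by positivity)]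
    exact norm_nonlin_sub_le σ (mem_closedBall_zero_iff.1 ha) (mem_closedBall_zero_iff.1 hb)

theorem continuous_nonlin (σ : ℝ) : Continuous (nonlin σ) :=
  continuous_iff_continuousAt.2 fun a =>
    (lipschitzOnWith_nonlin σ (‖a‖ + 1)).continuousOn.continuousAt
      (Metric.closedBall_mem_nhds_of_mem (by simp))

theorem exists_isSemilinearSol_truncate (σ M : ℝ) (a₀ : WeightedL2 (1 / 2)) :
    Continuous (truncate M (nonlin σ)) ∧
      ∃ a : ℝ → WeightedL2 (1 / 2), a 0 = a₀ ∧ IsSemilinearSol (truncate M (nonlin σ)) univ a := by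
  have hB : ∀ a : WeightedL2 (1 / 2), ‖a‖ ≤ M + 1 →
      ‖nonlin σ a‖ ≤ ((|σ| * (16 * (M + 1) ^ 3)).toNNReal : ℝ) := fun a ha =>
    (norm_nonlin_le σ ha).trans (Real.le_coe_toNNReal _)
  have hlip := lipschitzWith_truncate hB (lipschitzOnWith_nonlin σ (M + 1))
  exact ⟨hlip.continuous, exists_isSemilinearSol (norm_truncate_le hB) hlip a₀⟩

end Nonlinearity

section GlobalFlow

/-- An a priori bound for the norm at all times of a solution with initial norm at most `R`, read
off from conservation of mass and energy and the bound `4 R³ ‖a‖` for the quartic term. -/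
def growthBound (σ R : ℝ) : ℝ := 1 + R ^ 2 + 2 * |σ| * R ^ 4 + 2 * |σ| * R ^ 3

theorem growthBound_mono (σ : ℝ) {R R' : ℝ} (hR : 0 ≤ R) (h : R ≤ R') :
    growthBound σ R ≤ growthBound σ R' := by
  unfold growthBound
  gcongr

theorem quartic_le_of_mass_le {a : WeightedL2 (1 / 2)} {R : ℝ} (hR : 0 ≤ R)
    (h : a.mass ≤ R ^ 2) : a.quartic ≤ 4 * R ^ 3 * ‖a‖ :=
  calc a.quartic ≤ 4 * (√a.mass * ‖a‖) * a.mass := a.quartic_le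
    _ ≤ 4 * (R * ‖a‖) * R ^ 2 := by
        gcongr
        exacts [a.mass_nonneg, (Real.sqrt_le_left hR).2 h]
    _ = 4 * R ^ 3 * ‖a‖ := by ring

theorem norm_sq_le_of_mass_eq_of_energy_eq {σ R : ℝ} {a a₀ : WeightedL2 (1 / 2)} (h0 : ‖a₀‖ ≤ R)
    (hmass : a.mass = a₀.mass) (henergy : energy σ a = energy σ a₀) :
    ‖a‖ ^ 2 ≤ R ^ 2 + 2 * |σ| * R ^ 4 + 2 * |σ| * R ^ 3 * ‖a‖ := by
  have hR : 0 ≤ R := (norm_nonneg _).trans h0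
  have hmass0 : a₀.mass ≤ R ^ 2 := a₀.mass_le.trans (by gcongr)
  have hquartic0 : σ * a₀.quartic ≤ |σ| * (4 * R ^ 3 * R) :=
    mul_le_mul (le_abs_self σ) ((quartic_le_of_mass_le hR hmass0).trans (by gcongr))
      a₀.quartic_nonneg (abs_nonneg σ)
  have hquartic : -σ * a.quartic ≤ |σ| * (4 * R ^ 3 * ‖a‖) :=
    mul_le_mul (neg_le_abs σ) (quartic_le_of_mass_le hR (hmass ▸ hmass0)) a.quartic_nonneg
      (abs_nonneg σ)
  have hnorm0 : ‖a₀‖ ^ 2 ≤ R ^ 2 := by gcongr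
  unfold energy at henergy
  linarith

theorem norm_le_growthBound {σ R : ℝ} {a a₀ : WeightedL2 (1 / 2)} (h0 : ‖a₀‖ ≤ R)
    (hmass : a.mass = a₀.mass) (henergy : energy σ a = energy σ a₀) : ‖a‖ ≤ growthBound σ R := by
  have hR : 0 ≤ R := (norm_nonneg _).trans h0
  have hsq := norm_sq_le_of_mass_eq_of_energy_eq h0 hmass henergy
  have hconst : 0 ≤ R ^ 2 + 2 * |σ| * R ^ 4 := by positivity
  have hlin : 0 ≤ 2 * |σ| * R ^ 3 := by positivity
  unfold growthBound
  by_contra! hlt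
  nlinarith

variable {σ : ℝ}

theorem IsSemilinearSol.norm_le_growthBound {F : WeightedL2 (1 / 2) → WeightedL2 (1 / 2)} {M : ℝ}
    {a : ℝ → WeightedL2 (1 / 2)} (hF : Continuous F) (ha : IsSemilinearSol F univ a)
    (hFM : ∀ b, ‖b‖ ≤ M → F b = nonlin σ b) (hM : growthBound σ ‖a 0‖ < M) (t : ℝ) :
    ‖a t‖ ≤ growthBound σ ‖a 0‖ := by
  -- As long as mass and energy have their initial values, the norm stays below `M`, where `F` is
  -- the true nonlinearity and both quantities are stationary.
  have hconserved := eq_of_hasDerivAt_of_eventually_eq_zero (t₀ := 0)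
    (fun t => (ha.hasDerivAt_mass hF t).prodMk (ha.hasDerivAt_energy hF σ t)) (fun s hs => ?_) t
  · exact WeightedL2.norm_le_growthBound le_rfl (Prod.mk.inj hconserved).1
      (Prod.mk.inj hconserved).2
  · have hlt : ‖a s‖ < M := (WeightedL2.norm_le_growthBound le_rfl (Prod.mk.inj hs).1
      (Prod.mk.inj hs).2).trans_lt hM
    filter_upwards [(ha.continuous.norm.tendsto s).eventually (gt_mem_nhds hlt)] with τ hτ
    rw [hFM _ hτ.le, re_pairing_toDual_nonlin, energy_balance, mul_zero]
    rfl

theorem exists_global_solution (σ : ℝ) (a₀ : WeightedL2 (1 / 2)) : ∃ a : ℝ → WeightedL2 (1 / 2),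
    a 0 = a₀ ∧ IsSemilinearSol (nonlin σ) univ a ∧ ∀ t, ‖a t‖ ≤ growthBound σ ‖a₀‖ := by
  obtain ⟨hF, a, rfl, ha⟩ := exists_isSemilinearSol_truncate σ (growthBound σ ‖a₀‖ + 1) a₀
  have hbound := ha.norm_le_growthBound hF (fun _ => truncate_of_norm_le (nonlin σ))
    (lt_add_one _)
  refine ⟨a, rfl, ⟨ha.1, fun t ht n => ?_⟩, hbound⟩
  have hderiv := ha.2 t ht n
  rwa [truncate_of_norm_le _ (by linarith [hbound t])] at hderiv

theorem isSolutionOn_iff {I : Set ℝ} {a : ℝ → WeightedL2 (1 / 2)} :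
    IsSolutionOn σ I a ↔ IsSemilinearSol (nonlin σ) I a := by
  refine and_congr_right fun _ => forall₂_congr fun t _ => forall_congr' fun n => ⟨?_, fun h => ?_⟩
  · rintro ⟨d, S, hd, hS, heq⟩
    have hcubic : S = cubic (a t) n := hS.unique (hasSum_hermiteK_mul (a t) (a t) (a t) n)
    refine hd.congr_deriv ?_
    rw [nonlin, smul_apply, ← hcubic]
    linear_combination -Complex.I * heq + d * Complex.I_mul_I
  · refine ⟨_, _, h, hasSum_hermiteK_mul (a t) (a t) (a t) n, ?_⟩
    rw [nonlin, smul_apply, cubic]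
    linear_combination (-(n * a t n + σ * trilinear (a t) (a t) (a t) n)) * Complex.I_mul_I

namespace IsSemilinearSol

variable {a b : ℝ → WeightedL2 (1 / 2)} {t : ℝ}

theorem norm_sub_le_of_norm_le {R : ℝ} (ha : IsSemilinearSol (nonlin σ) (uIcc 0 t) a)
    (hb : IsSemilinearSol (nonlin σ) (uIcc 0 t) b) (hRa : ∀ τ ∈ uIcc 0 t, ‖a τ‖ ≤ R)
    (hRb : ∀ τ ∈ uIcc 0 t, ‖b τ‖ ≤ R) :
    ‖a t - b t‖ ≤ ‖a 0 - b 0‖ * Real.exp (|σ| * (48 * R ^ 2) * |t|) :=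
  ha.norm_sub_le (continuous_nonlin σ) hb fun τ hτ =>
    norm_nonlin_sub_le σ (hRa τ hτ) (hRb τ hτ)

theorem eq_of_initial_eq {I : Set ℝ} (hI : I.OrdConnected) (h0 : (0 : ℝ) ∈ I)
    (ha : IsSemilinearSol (nonlin σ) I a) (hb : IsSemilinearSol (nonlin σ) I b) (hab : a 0 = b 0)
    (ht : t ∈ I) : a t = b t := by
  have hsub : uIcc 0 t ⊆ I := hI.uIcc_subset h0 ht
  replace ha := ha.mono hsub
  replace hb := hb.mono hsub
  obtain ⟨A, hA⟩ := isCompact_uIcc.exists_bound_of_continuousOn ha.1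
  obtain ⟨B, hB⟩ := isCompact_uIcc.exists_bound_of_continuousOn hb.1
  have hle := ha.norm_sub_le_of_norm_le hb (fun τ hτ => (hA τ hτ).trans (le_max_left A B))
    (fun τ hτ => (hB τ hτ).trans (le_max_right A B))
  rw [hab, sub_self, norm_zero, zero_mul] at hle
  exact sub_eq_zero.1 (norm_le_zero_iff.1 hle)

theorem contDiff_toDual (ha : IsSemilinearSol (nonlin σ) univ a) :
    ContDiff ℝ 1 fun t => toDual (a t) := by
  have hderiv := ha.hasDerivAt_toDual (continuous_nonlin σ)
  exact contDiff_one_iff_deriv.2 ⟨fun t => (hderiv t).differentiableAt,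
    (ha.continuous_velocity (continuous_nonlin σ)).congr fun t => (hderiv t).deriv.symm⟩

end IsSemilinearSol

section Continuity

variable {Φ : ℝ → WeightedL2 (1 / 2) → WeightedL2 (1 / 2)}

theorem norm_flow_sub_le (h0 : ∀ a, Φ 0 a = a)
    (hsol : ∀ a, IsSemilinearSol (nonlin σ) univ fun t => Φ t a)
    (hbound : ∀ a t, ‖Φ t a‖ ≤ growthBound σ ‖a‖) {a b : WeightedL2 (1 / 2)} {R : ℝ}
    (ha : ‖a‖ ≤ R) (hb : ‖b‖ ≤ R) (t : ℝ) :
    ‖Φ t a - Φ t b‖ ≤ ‖a - b‖ * Real.exp (|σ| * (48 * growthBound σ R ^ 2) * |t|) := by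
  have hR {c : WeightedL2 (1 / 2)} (hc : ‖c‖ ≤ R) (τ : ℝ) : ‖Φ τ c‖ ≤ growthBound σ R :=
    (hbound c τ).trans (growthBound_mono σ (norm_nonneg c) hc)
  simpa only [h0] using ((hsol a).mono (subset_univ (uIcc 0 t))).norm_sub_le_of_norm_le
    ((hsol b).mono (subset_univ _)) (fun τ _ => hR ha τ) (fun τ _ => hR hb τ)

theorem continuous_flow (h0 : ∀ a, Φ 0 a = a)
    (hsol : ∀ a, IsSemilinearSol (nonlin σ) univ fun t => Φ t a)
    (hbound : ∀ a t, ‖Φ t a‖ ≤ growthBound σ ‖a‖) :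
    Continuous fun p : ℝ × WeightedL2 (1 / 2) => Φ p.1 p.2 := by
  refine continuous_iff_continuousAt.2 fun ⟨t₀, a₀⟩ => ?_
  set K := |σ| * (48 * growthBound σ (‖a₀‖ + 1) ^ 2)
  have horbit : Tendsto (fun p : ℝ × WeightedL2 (1 / 2) => Φ p.1 a₀) (𝓝 (t₀, a₀))
      (𝓝 (Φ t₀ a₀)) := ((hsol a₀).continuous.comp continuous_fst).tendsto (t₀, a₀)
  have hmajorant : Tendsto (fun p : ℝ × WeightedL2 (1 / 2) => ‖p.2 - a₀‖ * Real.exp (K * |p.1|))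
      (𝓝 (t₀, a₀)) (𝓝 0) := by
    have hcont : Continuous fun p : ℝ × WeightedL2 (1 / 2) =>
        ‖p.2 - a₀‖ * Real.exp (K * |p.1|) := by fun_prop
    simpa using hcont.tendsto (t₀, a₀)
  have hnear : ∀ᶠ p : ℝ × WeightedL2 (1 / 2) in 𝓝 (t₀, a₀), ‖p.2‖ < ‖a₀‖ + 1 :=
    (continuous_snd.norm.tendsto (t₀, a₀)).eventually (gt_mem_nhds (by simp))
  have hdiff : Tendsto (fun p : ℝ × WeightedL2 (1 / 2) => Φ p.1 p.2 - Φ p.1 a₀) (𝓝 (t₀, a₀))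
      (𝓝 0) := by
    refine squeeze_zero_norm' ?_ hmajorant
    filter_upwards [hnear] with p hp
    exact norm_flow_sub_le h0 hsol hbound hp.le (lt_add_one _).le p.1
  simpa only [ContinuousAt, sub_add_cancel, zero_add] using hdiff.add horbit

end Continuity

theorem isGloballyWellPosed (σ : ℝ) : IsGloballyWellPosed σ := by
  choose Ψ h0 hsol hbound using exists_global_solution σ
  refine ⟨fun t a => Ψ a t, continuous_flow h0 hsol hbound, fun a₀ =>
    ⟨h0 a₀, isSolutionOn_iff.2 (hsol a₀), ?_, fun I b hI h0I hb hb0 t ht => ?_⟩⟩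
  · simpa only [toDual_eq_incl] using (hsol a₀).contDiff_toDual
  · exact (isSolutionOn_iff.1 hb).eq_of_initial_eq hI h0I ((hsol a₀).mono (subset_univ I))
      (hb0.trans (h0 a₀).symm) ht

end GlobalFlow

end WeightedL2

theorem theorem2 (σ : ℝ) :
    -- the Hermite functions are complete: every `u ∈ L²(ℝ)` is the sum of its Hermite series
    (∀ u : ℝ → ℂ, MemLp u 2 → IsHermiteExpansion (hermiteCoeff u) u) ∧
    -- `u` lies in the energy space if and only if its coefficients lie in `l²_{1/2}(ℕ)`
    (∀ u : ℝ → ℂ, MemLp u 2 →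
      (MemEnergySpace u ↔ MemWeightedL2 (1 / 2) (hermiteCoeff u))) ∧
    -- every element of `l²_{1/2}(ℕ)` is the coefficient sequence of an element of that space
    (∀ a : WeightedL2 (1 / 2), ∃ u : ℝ → ℂ, MemEnergySpace u ∧ hermiteCoeff u = a) ∧
    -- the two norms agree up to the factor `√2`
    (∀ (u v : ℝ → ℂ) (a : WeightedL2 (1 / 2)), MemEnergySpace u → IsWeakDeriv u v →
      hermiteCoeff u = a → ∫ x, (‖v x‖ ^ 2 + (x ^ 2 + 1) * ‖u x‖ ^ 2) = 2 * ‖a‖ ^ 2) ∧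
    -- the discrete system is globally well-posed in `l²_{1/2}(ℕ)`
    IsGloballyWellPosed σ :=
  ⟨fun _ hu => isHermiteExpansion_hermiteCoeff hu, fun _ hu => memEnergySpace_iff hu,
    exists_memEnergySpace, fun _ _ _ hu hv ha => integral_energy_eq hu hv ha,
    WeightedL2.isGloballyWellPosed σ⟩

end
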